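/- Let $\mathbf{k}$ be a field of characteristic zero and let $q\in\mathbf{k}$ be such that $q^n\neq 1$ for all $n\ge 1$, or $q=1$. **Notation.** Put $[n]_q=1+q+\dots+q^{n-1}$, $[n]_q!=\prod_{i=1}^n[i]_q$ and $(t;q)_n=\prod_{i=1}^n(1-tq^{i-1})$. *Klyachko algebras.* Let $\mathcal K$ be the commutative $\mathbf{k}$-algebra generated by $u_i$ ($i\in\mathbb Z$) with relations $(q+1)u_i^2=q\,u_iu_{i-1}+u_iu_{i+1}$ for all $i\in\mathbb Z$. Let $\mathcal K_+$ be its quotient by the ideal generated by the $u_i$ with $i\le 0$, and let $\mathcal K_n$ be its quotient by the ideal generated by the $u_i$ with $i\le 0$ or $i\ge n$. Let $\rho_+:\mathbf{k}[x_1,x_2,\dots]\to\mathcal K_+$ and $\rho_n:\mathbf{k}[x_1,\dots,x_n]\to\mathcal K_n$ be the $\mathbf{k}$-algebra morphisms with $x_i\mapsto u_i-u_{i-1}$; thus $\rho_n(f)=f(u_1,u_2-u_1,\dots,u_{n-1}-u_{n-2},-u_{n-1})$. For a finite set $I$ of integers let $u_I=\prod_{i\in I}u_i$. *$q$-divided symmetrization.*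 For $f\in\mathbf{k}[x_1,\dots,x_n]$ let $$\langle f\rangle_n^q=\partial_{w_o}\left(\prod_{1\le i<j\le n}(qx_i-x_j)\cdot\frac{f}{\prod_{1\le i\le n-1}(qx_i-x_{i+1})}\right),\qquad \partial_{w_o}(g)=\frac{\sum_{w\in S_n}\mathrm{sgn}(w)\,w(g)}{\prod_{1\le i<j\le n}(x_i-x_j)},$$ where $S_n$ permutes the variables of rational functions in $x_1,\dots,x_n$. *Quasisymmetric functions.* A quasisymmetric function over $\mathbf{k}$ is a power series of bounded degree in $x_1,x_2,\dots$ such that, for all positive integers $\alpha_1,\dots,\alpha_l$, the coefficient of $x_{i_1}^{\alpha_1}\cdots x_{i_l}^{\alpha_l}$ is the same for all $i_1<\dots<i_l$; quasisymmetric polynomials in $x_1,\dots,x_n$ are defined by the same condition with $1\le i_1<\dots<i_l\le n$. Write $f(x_1,\dots,x_m)$ for $f$ with $x_i=0$ for all $i>m$. Let $\mathrm{QSym}_n^+\subset\mathbf{k}[x_1,\dots,x_n]$ be the ideal generated by the quasisymmetric polynomials without constant term. For a composition $\alpha=(\alpha_1,\dots,\alpha_\ell)$ of $r$ with positive parts,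 put $\ell(\alpha)=\ell$, $n(\alpha)=\sum_{i=1}^{\ell}(i-1)\alpha_i$, and $$F_\alpha(x_1,\dots,x_m)=\sum x_{i_1}\cdots x_{i_r},$$ the sum over all $1\le i_1\le\dots\le i_r\le m$ such that $i_j<i_{j+1}$ for every $j\in\{\alpha_1,\alpha_1+\alpha_2,\dots,\alpha_1+\dots+\alpha_{\ell-1}\}$. **Theorem.** Let $r\ge 1$, and let $f$ be a homogeneous quasisymmetric function of degree $r$ over $\mathbf{k}$. 1. For $0\le m\le r+1$ the rational function $\langle f(x_1,\dots,x_m)\rangle_{r+1}^q$ is a constant in $\mathbf{k}$, and in $\mathbf{k}[[t]]$ $$\sum_{j\ge 1}f(1,q,\dots,q^{j-1})\,t^j=\frac{\sum_{m=0}^{r+1}\langle f(x_1,\dots,x_m)\rangle_{r+1}^q\,t^m}{(t;q)_{r+1}}.$$ 2. $f(u_1,u_2-u_1,\dots,u_r-u_{r-1},-u_r)=0$ in $\mathcal K_{r+1}$. 3. $\langle g\rangle_{r+1}^q=0$ for every $g\in\mathrm{QSym}_{r+1}^+$ of degree at most $r$. Moreover: 4. For every composition $\alpha$ of $r$ and every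 $m\ge\ell(\alpha)$, in $\mathcal K_+$, $$\rho_+\bigl(F_\alpha(x_1,\dots,x_m)\bigr)=\frac{q^{n(\alpha)}}{[r]_q!}\;u_{\{1+m-\ell(\alpha),\,\dots,\,r+m-\ell(\alpha)\}}.$$ 5. For every composition $\alpha$ of $r$ and every $m$ with $\ell(\alpha)\le m\le r+1$, $\langle F_\alpha(x_1,\dots,x_m)\rangle_{r+1}^q$ equals $q^{n(\alpha)}$ if $m=\ell(\alpha)$, and $0$ otherwise. 6. For every $n\ge 0$ and every $g\in\mathrm{QSym}_n^+$, $\rho_n(g)=0$ in $\mathcal K_n$. -/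

import Mathlib

noncomputable section

namespace QKlyachko

/-! ### q-integers -/

/-- The `q`-integer `1 + q + ⋯ + q ^ (n - 1)`. -/
def qInt {k : Type*} [Field k] (q : k) (n : ℕ) : k :=
  ∑ i ∈ Finset.range n, q ^ i

/-- The `q`-factorial, the product of the `q`-integers of `1, …, n`. -/
def qFactorial {k : Type*} [Field k] (q : k) (n : ℕ) : k :=
  ∏ i ∈ Finset.range n, qInt q (i + 1)

/-- The `q`-Pochhammer symbol `(t; q)_n = ∏_{1 ≤ i ≤ n} (1 - t q ^ (i - 1))`, as a power series
in the variable `t`. -/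
def qPochhammer {k : Type*} [Field k] (q : k) (n : ℕ) : PowerSeries k :=
  ∏ i ∈ Finset.range n, (1 - PowerSeries.X * PowerSeries.C (q ^ i))

/-! ### Quasisymmetric functions and polynomials

The variables `x_1, x_2, …` are indexed from zero: `x_{i+1}` is the variable with index `i`. -/

/-- A formal power series in `x_1, x_2, …` is a quasisymmetric function if it has bounded degree
and, for all positive exponents `α_1, …, α_l`, the coefficient of
`x_{i_1} ^ α_1 ⋯ x_{i_l} ^ α_l` is the same for all `i_1 < ⋯ < i_l`. -/
structure IsQuasisymmetric {k : Type*} [Field k] (f : MvPowerSeries ℕ k) : Prop where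
  bounded : ∃ d : ℕ, ∀ e : ℕ →₀ ℕ, MvPowerSeries.coeff e f ≠ 0 → e.degree ≤ d
  coeff_eq : ∀ (l : ℕ) (α : Fin l → ℕ), (∀ j, 0 < α j) →
    ∀ i i' : Fin l → ℕ, StrictMono i → StrictMono i' →
      MvPowerSeries.coeff (∑ j, Finsupp.single (i j) (α j)) f =
        MvPowerSeries.coeff (∑ j, Finsupp.single (i' j) (α j)) f

/-- A polynomial in `x_1, …, x_n` is quasisymmetric if, for all positive exponents
`α_1, …, α_l`, the coefficient of `x_{i_1} ^ α_1 ⋯ x_{i_l} ^ α_l` is the same for all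
`i_1 < ⋯ < i_l`. -/
def IsQuasisymmetricPoly {k : Type*} [Field k] {n : ℕ} (p : MvPolynomial (Fin n) k) : Prop :=
  ∀ (l : ℕ) (α : Fin l → ℕ), (∀ j, 0 < α j) →
    ∀ i i' : Fin l → Fin n, StrictMono i → StrictMono i' →
      MvPolynomial.coeff (∑ j, Finsupp.single (i j) (α j)) p =
        MvPolynomial.coeff (∑ j, Finsupp.single (i' j) (α j)) p

/-- The truncation `f(x_1, …, x_m)` of a power series `f` of bounded degree: set `x_i = 0` for
`i > m`. The sum is finite because only finitely many monomials in `x_1, …, x_m` of bounded degree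
exist (see `coeff_truncate`). -/
def truncate {k : Type*} [Field k] (f : MvPowerSeries ℕ k) (m : ℕ) : MvPolynomial (Fin m) k :=
  ∑ᶠ e : Fin m →₀ ℕ,
    MvPolynomial.monomial e (MvPowerSeries.coeff (e.mapDomain Fin.val) f)

theorem coeff_truncate {k : Type*} [Field k] {f : MvPowerSeries ℕ k}
    (hf : ∃ d : ℕ, ∀ e : ℕ →₀ ℕ, MvPowerSeries.coeff e f ≠ 0 → e.degree ≤ d)
    (m : ℕ) (e : Fin m →₀ ℕ) :
    MvPolynomial.coeff e (truncate f m) = MvPowerSeries.coeff (e.mapDomain Fin.val) f := by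
  classical
  obtain ⟨d, hd⟩ := hf
  have hfin : (Function.support fun e : Fin m →₀ ℕ => MvPolynomial.monomial e
      (MvPowerSeries.coeff (e.mapDomain Fin.val) f)).Finite := by
    refine (Finsupp.finite_of_degree_le (σ := Fin m) d).subset fun e he => ?_
    have h := hd (e.mapDomain Fin.val) fun h0 => he (by simp [h0])
    have h1 : (e.mapDomain Fin.val).degree = e.degree := by
      rw [Finsupp.degree_mapDomain]
    simpa [h1] using h
  rw [truncate, finsum_eq_sum _ hfin, MvPolynomial.coeff_sum]
  simp only [MvPolynomial.coeff_monomial, Finset.sum_ite_eq']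
  split_ifs with h
  · rfl
  · by_contra hne
    exact h (by simpa using fun h0 => hne h0.symm)

/-- The ideal of `k[x_1, …, x_n]` generated by the quasisymmetric polynomials without constant
term. -/
def qsymIdeal (k : Type*) [Field k] (n : ℕ) : Ideal (MvPolynomial (Fin n) k) :=
  Ideal.span {p | IsQuasisymmetricPoly p ∧ MvPolynomial.constantCoeff p = 0}

/-- The set of proper nonempty partial sums
`{α_1, α_1 + α_2, …, α_1 + ⋯ + α_{l - 1}} ⊆ {1, …, d - 1}` of a composition `α` of `d` with `l`
parts. -/
def partialSums {d : ℕ} (α : Composition d) : Finset ℕ :=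
  (Finset.Ioo 0 α.length).image α.sizeUpTo

open scoped Classical in
/-- The fundamental quasisymmetric polynomial `F_α(x_1, …, x_m)`: the sum of
`x_{i_1} ⋯ x_{i_d}` over `1 ≤ i_1 ≤ ⋯ ≤ i_d ≤ m` such that `i_j < i_{j+1}` whenever `j` is a
proper partial sum of `α`. (The position `j` has index `j - 1` in `Fin d`, so the condition
on positions `j`, `j + 1` concerns the indices `a = j - 1` and `b = j`.) -/
def fundamental (k : Type*) [Field k] {d : ℕ} (α : Composition d) (m : ℕ) :
    MvPolynomial (Fin m) k :=
  ∑ i : Fin d → Fin m with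
    Monotone i ∧ ∀ a b : Fin d, (b : ℕ) = a + 1 → (b : ℕ) ∈ partialSums α → i a < i b,
    ∏ a, MvPolynomial.X (i a)

/-- The statistic `n(α) = ∑_{1 ≤ i ≤ l} (i - 1) α_i` of a composition. -/
def nStat {d : ℕ} (α : Composition d) : ℕ :=
  ∑ i : Fin α.length, (i : ℕ) * α.blocksFun i

/-! ### The Klyachko algebras -/

/-- The ideal generated by `(q + 1) z_i ^ 2 - q z_i z_{i-1} - z_i z_{i+1}` for `i ∈ ℤ` and by the
`z_i` with `i ∉ I`. -/
def klyachkoIdeal {k : Type*} [Field k] (q : k) (I : Set ℤ) : Ideal (MvPolynomial ℤ k) :=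
  Ideal.span (Set.range fun i : ℤ =>
      MvPolynomial.C (q + 1) * MvPolynomial.X i ^ 2
        - MvPolynomial.C q * MvPolynomial.X i * MvPolynomial.X (i - 1)
        - MvPolynomial.X i * MvPolynomial.X (i + 1)) ⊔
    Ideal.span (MvPolynomial.X '' Iᶜ)

/-- The algebra `K_I`: generators `u_i`, `i ∈ ℤ`, and relations
`(q + 1) u_i ^ 2 = q u_i u_{i-1} + u_i u_{i+1}` for all `i`, and `u_i = 0` for `i ∉ I`. -/
abbrev Klyachko {k : Type*} [Field k] (q : k) (I : Set ℤ) : Type _ :=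
  MvPolynomial ℤ k ⧸ klyachkoIdeal q I

/-- The generator `u_i` of `K_I` (it is zero for `i ∉ I`). -/
def u {k : Type*} [Field k] (q : k) (I : Set ℤ) (i : ℤ) : Klyachko q I :=
  Ideal.Quotient.mk (klyachkoIdeal q I) (MvPolynomial.X i)

/-- The algebra `K_+`, where `u_i = 0` for `i ≤ 0`. -/
abbrev KlyachkoPos {k : Type*} [Field k] (q : k) : Type _ :=
  Klyachko q (Set.Ioi 0)

/-- The algebra `K_n`, where `u_i = 0` unless `1 ≤ i ≤ n - 1`. -/
abbrev KlyachkoFin {k : Type*} [Field k] (q : k) (n : ℕ) : Type _ :=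
  Klyachko q (Set.Ioo 0 (n : ℤ))

/-- The morphism `ρ_+ : k[x_1, x_2, …] → K_+`, `x_i ↦ u_i - u_{i-1}` (with `u_0 = 0`). -/
def rhoPos {k : Type*} [Field k] (q : k) : MvPolynomial ℕ k →ₐ[k] KlyachkoPos q :=
  MvPolynomial.aeval fun i : ℕ =>
    u q (Set.Ioi 0) ((i : ℤ) + 1) - u q (Set.Ioi 0) (i : ℤ)

/-- The morphism `ρ_n : k[x_1, …, x_n] → K_n`, `x_i ↦ u_i - u_{i-1}` (with `u_0 = u_n = 0`), that
is, `f ↦ f(u_1, u_2 - u_1, …, u_{n-1} - u_{n-2}, -u_{n-1})`. -/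
def rhoFin {k : Type*} [Field k] (q : k) (n : ℕ) :
    MvPolynomial (Fin n) k →ₐ[k] KlyachkoFin q n :=
  MvPolynomial.aeval fun i : Fin n =>
    u q (Set.Ioo 0 (n : ℤ)) ((i : ℤ) + 1) - u q (Set.Ioo 0 (n : ℤ)) (i : ℤ)

/-! ### q-divided symmetrization -/

/-- The field of rational functions in `x_1, …, x_n`. -/
abbrev RatFun (k : Type*) [Field k] (n : ℕ) : Type _ :=
  FractionRing (MvPolynomial (Fin n) k)

/-- The variable `x_{i+1}` as a rational function. -/
def ratX (k : Type*) [Field k] {n : ℕ} (i : Fin n) : RatFun k n :=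
  algebraMap (MvPolynomial (Fin n) k) (RatFun k n) (MvPolynomial.X i)

/-- The action of a permutation on rational functions by permuting the variables. -/
def permAct (k : Type*) [Field k] {n : ℕ} (w : Equiv.Perm (Fin n)) : RatFun k n ≃+* RatFun k n :=
  IsFractionRing.ringEquivOfRingEquiv (MvPolynomial.renameEquiv k w).toRingEquiv

/-- The operator `∂_{w_o}`: antisymmetrization followed by division by the Vandermonde product
`∏_{i < j} (x_i - x_j)`. -/
def partialLongest {k : Type*} [Field k] {n : ℕ} (g : RatFun k n) : RatFun k n :=
  (∑ w : Equiv.Perm (Fin n), ((Equiv.Perm.sign w : ℤ) : RatFun k n) * permAct k w g) /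
    ∏ i : Fin n, ∏ j ∈ Finset.Ioi i, (ratX k i - ratX k j)

/-- The operator `□_{w_o} = ∂_{w_o} ∏_{i < j} (q x_i - x_j)`: first multiply by the product, then
apply `∂_{w_o}`. -/
def squareLongest {k : Type*} [Field k] (q : k) {n : ℕ} (g : RatFun k n) : RatFun k n :=
  partialLongest
    ((∏ i : Fin n, ∏ j ∈ Finset.Ioi i, (algebraMap k (RatFun k n) q * ratX k i - ratX k j)) * g)

/-- The `q`-divided symmetrization
`⟨f⟩_n^q = □_{w_o} (f / ∏_{1 ≤ i ≤ n - 1} (q x_i - x_{i+1}))`. -/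
def qDS {k : Type*} [Field k] (q : k) {n : ℕ} (f : MvPolynomial (Fin n) k) : RatFun k n :=
  squareLongest q
    (algebraMap (MvPolynomial (Fin n) k) (RatFun k n) f /
      ∏ i : Fin n, ∏ j ∈ Finset.univ.filter (fun j : Fin n => (j : ℕ) = (i : ℕ) + 1),
        (algebraMap k (RatFun k n) q * ratX k i - ratX k j))

end QKlyachko

end

noncomputable section

namespace QKlyachko

open Finset

/-! Everything reduces to the fundamental polynomials `F_S`, where `S` is the set of positions of
forced strict increases. In a quasisymmetric function the coefficient of a weakly increasing word
depends only on its ascent set, and inclusion-exclusion over subsets turns this into an expansion in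
the `F_S` whose coefficients depend neither on the number of variables nor on the point of
evaluation.

Splitting off the last letter gives the recursion behind `fundEval`. When `x_j = u_j - u_{j-1}` and
the Klyachko relations hold, it yields `[r]! F_S(x_1, …, x_{l+s}) = q^{n(S)} u_{1+s} ⋯ u_{r+s}`,
where `l` is the number of parts (`qfact_mul_fundEval`): the relations make the increments of the
right-hand side telescope. If moreover `u_n = 0`, the product vanishes whenever it contains `u_n`,
which gives the vanishing of `ρ_n`. For `x_j = q^{j-1}` the same recursion gives the generating
function `q^{n(S)} t^l / (t;q)_{r+1}` (`mk_fundEval_mul_qPochhammer`).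

The link with `q`-divided symmetrization is that, in degree `r` and `r + 1` variables, it kills the
ideal of the Klyachko relations written with `u_i = x_1 + ⋯ + x_i`
(`antisym_eq_zero_of_mem_relationIdeal`). Indeed, antisymmetrization kills every monomial with two
equal exponents, and low degree forces equal exponents. Modulo the relations, `F_S(x_1, …, x_m)` is
`q^{n(S)} x_1^r` if `m = l` and `0` for other `m ≤ r + 1`, so only the normalization `⟨x_1^r⟩ = 1`
remains (`antisym_X_zero_pow`). The symmetrizations are then exactly the numerator coefficients of
the generating function. -/

/-! ### Evaluations of fundamental quasisymmetric polynomials -/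

/-- The value at `x` of the fundamental quasisymmetric polynomial in `m` variables of degree `r`,
with strict increases at the positions in `S`, by recursion on the last index. -/
def fundEval {A : Type*} [CommSemiring A] (x : ℕ → A) (S : Finset ℕ) : ℕ → ℕ → A
  | 0, _ => 1
  | r + 1, m => ∑ j ∈ range m, x j * fundEval x S r (if r ∈ S then j else j + 1)

/-- Weakly increasing words which increase strictly at the positions in `S`. -/
def IsWord {X : Type*} [Preorder X] (S : Finset ℕ) {r : ℕ} (i : Fin r → X) : Prop :=
  Monotone i ∧ ∀ a b : Fin r, (b : ℕ) = a + 1 → (b : ℕ) ∈ S → i a < i b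

/-- By monotonicity only the last letter of `i` has to be compared with `j`; the strict or weak
comparison becomes the bound `j` or `j + 1` on all letters of `i`. -/
theorem isWord_snoc {S : Finset ℕ} {r m : ℕ} (i : Fin r → ℕ) (j : ℕ) :
    ((∀ a, (Fin.snoc i j : Fin (r + 1) → ℕ) a < m) ∧
      IsWord S (Fin.snoc i j : Fin (r + 1) → ℕ)) ↔
      j < m ∧ (∀ a, i a < if r ∈ S then j else j + 1) ∧ IsWord S i := by
  constructor
  · rintro ⟨h1, h2, h3⟩
    have hj : j < m := by simpa using h1 (Fin.last r)
    refine ⟨hj, fun a => ?_, fun a b hab => ?_, fun a b hab hb => ?_⟩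
    · have hr : 0 < r := a.pos
      have hlast : i a ≤ i ⟨r - 1, by omega⟩ := by
        have := h2 (a := a.castSucc) (b := (⟨r - 1, by omega⟩ : Fin r).castSucc)
          (by rw [Fin.castSucc_le_castSucc_iff, Fin.le_def]; simp; omega)
        simpa only [Fin.snoc_castSucc] using this
      split_ifs with hrS
      · have := h3 (⟨r - 1, by omega⟩ : Fin r).castSucc (Fin.last r) (by simp; omega) (by simpa)
        simp only [Fin.snoc_castSucc, Fin.snoc_last] at this
        omega
      · have := h2 (a := (⟨r - 1, by omega⟩ : Fin r).castSucc) (b := Fin.last r) (Fin.le_last _)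
        simp only [Fin.snoc_castSucc, Fin.snoc_last] at this
        omega
    · have := h2 (a := a.castSucc) (b := b.castSucc) (by simpa using hab)
      simpa only [Fin.snoc_castSucc] using this
    · have := h3 a.castSucc b.castSucc (by simpa using hab) (by simpa using hb)
      simpa only [Fin.snoc_castSucc] using this
  · rintro ⟨hj, h1, h2, h3⟩
    have h1' : ∀ a, i a ≤ j := fun a => by
      have := h1 a
      split_ifs at this <;> omega
    refine ⟨fun a => ?_, fun a b hab => ?_, fun a b hab hb => ?_⟩
    · induction a using Fin.lastCases with
      | last => simpa using hj
      | cast a => simpa using (h1' a).trans_lt hj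
    · induction b using Fin.lastCases with
      | last =>
        induction a using Fin.lastCases with
        | last => exact le_rfl
        | cast a => simpa using h1' a
      | cast b =>
        induction a using Fin.lastCases with
        | last => exact absurd hab (by simp [Fin.le_def])
        | cast a => simpa using h2 (by simpa using hab)
    · induction b using Fin.lastCases with
      | last =>
        induction a using Fin.lastCases with
        | last => simp at hab
        | cast a =>
          simp only [Fin.val_last] at hb
          simpa [hb] using h1 a
      | cast b =>
        induction a using Fin.lastCases with
        | last => simp at hab; omega
        | cast a => simpa using h3 a b (by simpa using hab) (by simpa using hb)

open scoped Classical in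
theorem fundEval_eq_sum_nat {A : Type*} [CommSemiring A] (x : ℕ → A) (S : Finset ℕ)
    (r m : ℕ) :
    fundEval x S r m =
      ∑ i ∈ (Fintype.piFinset fun _ : Fin r => range m) with IsWord S i, ∏ a, x (i a) := by
  induction r generalizing m with
  | zero =>
    have : IsWord S (default : Fin 0 → ℕ) := ⟨fun a => a.elim0, fun a => a.elim0⟩
    have h2 : ∀ i : Fin 0 → ℕ, IsWord S i := fun i => Subsingleton.elim default i ▸ this
    simp [fundEval, h2]
  | succ r ih =>
    simp only [fundEval, ih, mul_sum]
    rw [sum_sigma']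
    refine sum_bij' (fun p _ => (Fin.snoc p.2 p.1 : Fin (r + 1) → ℕ))
      (fun i _ => ⟨i (Fin.last r), Fin.init i⟩) ?_ ?_ ?_ ?_ ?_
    · rintro ⟨j, i⟩ h
      have := (isWord_snoc (m := m) i j).2 (by simpa using h)
      simpa using this
    · intro i h
      have := (isWord_snoc (m := m) (Fin.init i) (i (Fin.last r))).1 (by simpa using h)
      simpa using this
    · rintro ⟨j, i⟩ h
      simp
    · intro i h
      simp
    · rintro ⟨j, i⟩ h
      simp [Fin.prod_univ_castSucc, mul_comm]

theorem isWord_val_comp {S : Finset ℕ} {r m : ℕ} (i : Fin r → Fin m) :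
    IsWord S (fun a => (i a : ℕ)) ↔ IsWord S i := Iff.rfl

open scoped Classical in
theorem fundEval_eq_sum {A : Type*} [CommSemiring A] (x : ℕ → A) (S : Finset ℕ)
    (r m : ℕ) :
    fundEval x S r m = ∑ i : Fin r → Fin m with IsWord S i, ∏ a, x (i a) := by
  rw [fundEval_eq_sum_nat x S]
  symm
  refine sum_bij (fun i _ a => (i a : ℕ)) ?_ ?_ ?_ ?_
  · intro i h
    simpa [isWord_val_comp] using h
  · intro i _ i' _ h
    funext a
    exact Fin.ext (congrFun h a)
  · intro i h
    simp only [mem_filter, Fintype.mem_piFinset, mem_range] at h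
    exact ⟨fun a => ⟨i a, h.1 a⟩, by
      simpa using (isWord_val_comp _).1 h.2, rfl⟩
  · intro i _
    rfl

/-- The number of positions below `r` in `S`; the number of parts of a composition of `r`. -/
def numParts (S : Finset ℕ) (r : ℕ) : ℕ := #{j ∈ range r | j ∈ S}

/-- The statistic `n(α)` in terms of the set of positions of the strict increases. -/
def descStat (S : Finset ℕ) (r : ℕ) : ℕ := ∑ j ∈ range r, (numParts S (j + 1) - 1)

theorem numParts_zero (S : Finset ℕ) : numParts S 0 = 0 := by simp [numParts]

theorem numParts_succ (S : Finset ℕ) (r : ℕ) :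
    numParts S (r + 1) = numParts S r + if r ∈ S then 1 else 0 := by
  rw [numParts, range_add_one, filter_insert]
  split_ifs with h
  · rw [card_insert_of_notMem (by simp)]; rfl
  · rfl

theorem numParts_pos {S : Finset ℕ} (hS : 0 ∈ S) {r : ℕ} (hr : 0 < r) : 0 < numParts S r :=
  card_pos.2 ⟨0, by simp [hS, hr]⟩

theorem numParts_le (S : Finset ℕ) (r : ℕ) : numParts S r ≤ r :=
  (card_filter_le _ _).trans (by simp)

theorem descStat_succ (S : Finset ℕ) (r : ℕ) :
    descStat S (r + 1) = descStat S r + (numParts S (r + 1) - 1) := sum_range_succ _ _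

/-- Each part of the composition needs a letter of its own, so with fewer variables than parts there
is no word. -/
theorem fundEval_eq_zero {A : Type*} [CommSemiring A] (x : ℕ → A) {S : Finset ℕ} {r m : ℕ}
    (h : m < numParts S r) : fundEval x S r m = 0 := by
  induction r generalizing m with
  | zero => simp [numParts_zero] at h
  | succ r ih =>
    rw [numParts_succ] at h
    refine sum_eq_zero fun j hj => ?_
    rw [mem_range] at hj
    rw [ih, mul_zero]
    split_ifs at h ⊢ <;> omega

theorem fundEval_succ_succ {A : Type*} [CommSemiring A] (x : ℕ → A) (S : Finset ℕ) (r m : ℕ) :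
    fundEval x S (r + 1) (m + 1) =
      fundEval x S (r + 1) m + x m * fundEval x S r (if r ∈ S then m else m + 1) := by
  simp only [fundEval]
  rw [sum_range_succ]

/-! ### Fundamental quasisymmetric polynomials under the Klyachko relations -/

section Relations

variable {A : Type*} [CommRing A] {q : A} {v : ℕ → A}

/-- In the presence of the factor `v (s + j + 1)`, the relation lowers the index of a consecutive
difference by one at the cost of a factor `q`. The product supplies these factors for all `j < r`.
-/
theorem prod_mul_diff (hrel : ∀ j, v (j + 1) * (v (j + 2) - v (j + 1)) =
      q * (v (j + 1) * (v (j + 1) - v j))) (r s : ℕ) {j : ℕ} (hj : j ≤ r) :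
    (∏ i ∈ range r, v (i + 1 + s)) * (v (s + j + 1) - v (s + j)) =
      q ^ j * ((∏ i ∈ range r, v (i + 1 + s)) * (v (s + 1) - v s)) := by
  induction j with
  | zero => simp
  | succ j ih =>
    rw [pow_succ', mul_assoc, ← ih (by omega),
      ← mul_prod_erase (range r) _ (mem_range.2 (show j < r by omega)),
      show j + 1 + s = s + j + 1 by omega, show s + (j + 1) = s + j + 1 by omega]
    linear_combination (∏ i ∈ (range r).erase j, v (i + 1 + s)) * hrel (s + j)

/-- The differences of `v` between `s` and `s + r + 1` form, after multiplication by the product, a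
geometric progression; summing it produces the `q`-integer. -/
theorem prod_mul_sub (hrel : ∀ j, v (j + 1) * (v (j + 2) - v (j + 1)) =
      q * (v (j + 1) * (v (j + 1) - v j))) (r s : ℕ) :
    (∏ i ∈ range r, v (i + 1 + s)) * (v (s + (r + 1)) - v s) =
      (∑ i ∈ range (r + 1), q ^ i) * ((∏ i ∈ range r, v (i + 1 + s)) * (v (s + 1) - v s)) := by
  have : v (s + (r + 1)) - v s = ∑ j ∈ range (r + 1), (v (s + j + 1) - v (s + j)) := by
    have := sum_range_sub (fun j => v (s + j)) (r + 1)
    simpa [add_assoc] using this.symm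
  rw [this, mul_sum, sum_mul]
  exact sum_congr rfl fun j hj => prod_mul_diff hrel r s (by simpa [Nat.lt_succ_iff] using hj)

/-- Double induction, on the degree `r` and on the number `s` of variables beyond the number of
parts. Both sides have the same increments in `s`. -/
theorem qfact_mul_fundEval (h0 : v 0 = 0) (hrel : ∀ j, v (j + 1) * (v (j + 2) - v (j + 1)) =
      q * (v (j + 1) * (v (j + 1) - v j))) {S : Finset ℕ} (hS : 0 ∈ S) (r s : ℕ) :
    (∏ i ∈ range r, ∑ j ∈ range (i + 1), q ^ j) *
        fundEval (fun j => v (j + 1) - v j) S r (numParts S r + s) =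
      q ^ descStat S r * ∏ i ∈ range r, v (i + 1 + s) := by
  induction r generalizing s with
  | zero => simp [fundEval, descStat]
  | succ r ihr =>
    obtain ⟨l, hl⟩ : ∃ l, numParts S (r + 1) = l + 1 :=
      ⟨numParts S (r + 1) - 1, by
        have : 0 < numParts S (r + 1) := numParts_pos hS (Nat.succ_pos r)
        omega⟩
    have hstep : ∀ s, fundEval (fun j => v (j + 1) - v j) S (r + 1) (l + 1 + s) =
        fundEval (fun j => v (j + 1) - v j) S (r + 1) (l + s) +
          (v (s + l + 1) - v (s + l)) *
            fundEval (fun j => v (j + 1) - v j) S r (numParts S r + s) := by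
      intro s
      rw [show l + 1 + s = l + s + 1 by omega, fundEval_succ_succ, add_comm l s]
      rw [numParts_succ] at hl
      congr 3
      split_ifs at hl ⊢ <;> omega
    have hlr : l ≤ r := by have := numParts_le S (r + 1); omega
    -- The increment in `s`: `prod_mul_diff` replaces the last variable by `q ^ l` times the
    -- difference at `s`, and `prod_mul_sub` absorbs the new `q`-integer, leaving a difference of
    -- two products of `r + 1` consecutive `v`'s.
    have hinc : ∀ s, (∏ i ∈ range (r + 1), ∑ j ∈ range (i + 1), q ^ j) *
        ((v (s + l + 1) - v (s + l)) *
          fundEval (fun j => v (j + 1) - v j) S r (numParts S r + s)) =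
        q ^ descStat S (r + 1) *
          ((∏ i ∈ range (r + 1), v (i + 1 + s)) - ∏ i ∈ range (r + 1), v (i + s)) := by
      intro s
      rw [prod_range_succ, descStat_succ, hl, Nat.add_sub_cancel, pow_add,
        prod_range_succ (fun i => v (i + 1 + s)), prod_range_succ' (fun i => v (i + s))]
      have h1 := prod_mul_diff hrel r s hlr
      have h2 := prod_mul_sub hrel r s
      have h3 := ihr s
      rw [show r + 1 + s = s + (r + 1) by omega, zero_add]
      linear_combination (∑ j ∈ range (r + 1), q ^ j) * (v (s + l + 1) - v (s + l)) * h3 +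
        q ^ descStat S r * (∑ j ∈ range (r + 1), q ^ j) * h1 - q ^ descStat S r * q ^ l * h2
    rw [hl]
    induction s with
    | zero =>
      -- At `s = 0` both subtracted terms vanish: one has too few variables, the other contains `v
      -- 0`.
      rw [hstep, mul_add, hinc, fundEval_eq_zero _ (by omega : l + 0 < numParts S (r + 1))]
      rw [prod_range_succ' (fun i => v (i + 0))]
      simp [h0]
    | succ s ihs =>
      rw [hstep, mul_add, hinc, show l + (s + 1) = l + 1 + s by omega, ihs]
      simp only [show ∀ i, i + (s + 1) = i + 1 + s by intro i; omega]
      ring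

end Relations

/-! ### Principal specializations -/

theorem rescale_C {k : Type*} [Field k] (q a : k) :
    PowerSeries.rescale q (PowerSeries.C a) = PowerSeries.C a := by
  ext j
  rcases j with _ | j <;> simp [PowerSeries.coeff_C]

theorem one_sub_X_mul_rescale_qPochhammer {k : Type*} [Field k] (q : k) (r : ℕ) :
    (1 - PowerSeries.X) * PowerSeries.rescale q (qPochhammer q r) = qPochhammer q (r + 1) := by
  rw [qPochhammer, qPochhammer, prod_range_succ', map_prod, mul_comm]
  congr 1
  · refine prod_congr rfl fun i _ => ?_
    rw [map_sub, map_mul, map_one, PowerSeries.rescale_X, rescale_C, pow_succ', map_mul]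
    ring
  · simp

/-- Multiplication by `1 - t` takes differences in the number of variables. The last letter then
contributes `q ^ j`, which is a rescaling of `t` by `q`, and rescaling turns `(t; q)_{r+1}` into the
remaining factors of `(t; q)_{r+2}`. -/
theorem mk_fundEval_mul_qPochhammer {k : Type*} [Field k] (q : k) {S : Finset ℕ} (hS : 0 ∈ S)
    (r : ℕ) :
    PowerSeries.mk (fundEval (fun j => q ^ j) S r) * qPochhammer q (r + 1) =
      PowerSeries.C (q ^ descStat S r) * PowerSeries.X ^ numParts S r := by
  induction r with
  | zero =>
    have : (PowerSeries.mk (fundEval (fun j => q ^ j) S 0) : PowerSeries k) =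
        PowerSeries.mk 1 := by
      ext; simp [fundEval]
    rw [this]
    simp [qPochhammer, descStat, numParts, PowerSeries.mk_one_mul_one_sub_eq_one]
  | succ r ih =>
    set x : ℕ → k := fun j => q ^ j with hx
    have h0 : fundEval x S (r + 1) 0 = 0 := by simp [fundEval]
    have hdiff : (1 - PowerSeries.X) * PowerSeries.mk (fundEval x S (r + 1)) =
        PowerSeries.X * PowerSeries.rescale q
          (PowerSeries.mk fun j => fundEval x S r (if r ∈ S then j else j + 1)) := by
      ext j
      rcases j with _ | j
      · simp [h0]
      · simp [sub_mul, PowerSeries.coeff_succ_X_mul, fundEval_succ_succ, hx]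
    have key : PowerSeries.mk (fun j => fundEval x S r (if r ∈ S then j else j + 1)) *
        qPochhammer q (r + 1) =
          PowerSeries.C (q ^ descStat S r) * PowerSeries.X ^ (numParts S (r + 1) - 1) := by
      rw [numParts_succ]
      split_ifs with hrS
      · simpa using ih
      · have hr : 0 < r := Nat.pos_of_ne_zero fun h => hrS (h ▸ hS)
        have hpos := numParts_pos hS hr
        have h0 : fundEval x S r 0 = 0 := fundEval_eq_zero x hpos
        -- Without a strict increase at `r` the sequence is shifted by one; its term at `0`
        -- vanishes, so the shift is division by `t`.
        have hX : (PowerSeries.mk (fundEval x S r) : PowerSeries k) =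
            PowerSeries.X * PowerSeries.mk fun j => fundEval x S r (j + 1) := by
          ext j
          rcases j with _ | j
          · simp [h0]
          · simp [PowerSeries.coeff_succ_X_mul]
        apply mul_left_cancel₀ (PowerSeries.X_ne_zero (R := k))
        rw [← mul_assoc, ← hX, ih, mul_left_comm, ← pow_succ']
        congr 2
        omega
    have hpos : 0 < numParts S (r + 1) := numParts_pos hS (Nat.succ_pos r)
    obtain ⟨l, hl⟩ : ∃ l, numParts S (r + 1) = l + 1 := ⟨numParts S (r + 1) - 1, by omega⟩
    rw [← one_sub_X_mul_rescale_qPochhammer, mul_left_comm, ← mul_assoc, hdiff, mul_assoc,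
      ← map_mul, key, descStat_succ, hl, Nat.add_sub_cancel, map_mul, rescale_C,
      map_pow (PowerSeries.rescale q), PowerSeries.rescale_X, mul_pow, pow_add q, map_mul,
      map_pow PowerSeries.C q l]
    ring

/-! ### Compositions -/

theorem insert_zero_partialSums {d : ℕ} (hd : 0 < d) (α : Composition d) :
    insert 0 (partialSums α) = (range α.length).image α.sizeUpTo := by
  have : range α.length = insert 0 (Ioo 0 α.length) := by
    ext i
    have := (α.length_pos_iff).2 hd
    simp; omega
  rw [this, image_insert, partialSums, Composition.sizeUpTo_zero]

theorem strictMonoOn_sizeUpTo {d : ℕ} (α : Composition d) {i j : ℕ} (hij : i < j)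
    (hj : j ≤ α.length) : α.sizeUpTo i < α.sizeUpTo j :=
  (α.sizeUpTo_strict_mono (by omega)).trans_le (α.monotone_sizeUpTo hij)

theorem card_image_sizeUpTo {d : ℕ} (α : Composition d) {l : ℕ} (hl : l ≤ α.length) :
    #((range l).image α.sizeUpTo) = l := by
  rw [card_image_of_injOn, card_range]
  intro i hi j hj h
  simp only [coe_range, Set.mem_Iio] at hi hj
  rcases lt_trichotomy i j with hij | hij | hij
  · exact absurd h (strictMonoOn_sizeUpTo α hij (by omega)).ne
  · exact hij
  · exact absurd h (strictMonoOn_sizeUpTo α hij (by omega)).ne'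

theorem numParts_insert_partialSums {d : ℕ} (hd : 0 < d) (α : Composition d) :
    numParts (insert 0 (partialSums α)) d = α.length := by
  rw [numParts, insert_zero_partialSums hd]
  conv_rhs => rw [← card_image_sizeUpTo α le_rfl]
  congr 1
  ext t
  simp only [mem_filter, mem_range, mem_image, and_iff_right_iff_imp]
  rintro ⟨i, hi, rfl⟩
  simpa using strictMonoOn_sizeUpTo α hi le_rfl

/-- Thus each position contributes the zero-based index of its block to `descStat`, and grouping the
positions by blocks gives `nStat`. -/
theorem numParts_succ_insert_partialSums {d : ℕ} (α : Composition d) (j : Fin d) :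
    numParts (insert 0 (partialSums α)) (j + 1) = α.index j + 1 := by
  rw [numParts, insert_zero_partialSums j.pos]
  conv_rhs =>
    rw [← card_image_sizeUpTo α
      (show (α.index j : ℕ) + 1 ≤ α.length from (α.index j).is_lt)]
  congr 1
  ext t
  simp only [mem_filter, mem_range, mem_image, Nat.lt_succ_iff]
  constructor
  · rintro ⟨ht, i, hi, rfl⟩
    refine ⟨i, ?_, rfl⟩
    by_contra! h
    have h1 := α.monotone_sizeUpTo (show (α.index j : ℕ) + 1 ≤ i from h)
    have h2 : (j : ℕ) < α.sizeUpTo (α.index j + 1) := α.lt_sizeUpTo_index_succ j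
    omega
  · rintro ⟨i, hi, rfl⟩
    exact ⟨(α.monotone_sizeUpTo hi).trans (α.sizeUpTo_index_le j), i, by omega, rfl⟩

theorem descStat_insert_partialSums {d : ℕ} (α : Composition d) :
    descStat (insert 0 (partialSums α)) d = nStat α := by
  rw [descStat, ← Fin.sum_univ_eq_sum_range
    (fun j => numParts (insert 0 (partialSums α)) (j + 1) - 1), nStat]
  simp only [numParts_succ_insert_partialSums, Nat.add_sub_cancel]
  rw [← α.blocksFinEquiv.sum_comp, Fintype.sum_sigma]
  refine sum_congr rfl fun i _ => ?_
  simp [Composition.blocksFinEquiv, mul_comm]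

open scoped Classical in
/-- Evaluating a fundamental quasisymmetric polynomial. -/
theorem aeval_fundamental {k A : Type*} [Field k] [CommRing A] [Algebra k A] (x : ℕ → A) {d : ℕ}
    (α : Composition d) (m : ℕ) :
    MvPolynomial.aeval (fun i : Fin m => x i) (fundamental k α m) =
      fundEval x (insert 0 (partialSums α)) d m := by
  rw [fundEval_eq_sum, fundamental, map_sum]
  simp only [map_prod, MvPolynomial.aeval_X]
  refine sum_congr (filter_congr fun i _ => and_congr_right fun _ => ?_) fun _ _ => rfl
  refine forall₂_congr fun a b => forall_congr' fun hab => ?_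
  rw [mem_insert, or_iff_right (by omega)]

/-! ### Expansion of quasisymmetric polynomials in the fundamental ones -/

/-- The set of positions of the strict increases of a word. -/
def ascents {X : Type*} [Preorder X] [DecidableLT X] {r : ℕ} (i : Fin r → X) : Finset ℕ :=
  {t ∈ Ioo 0 r | ∃ a b : Fin r, (b : ℕ) = a + 1 ∧ (b : ℕ) = t ∧ i a < i b}

theorem ascents_subset {X : Type*} [Preorder X] [DecidableLT X] {r : ℕ} (i : Fin r → X) :
    ascents i ⊆ Ioo 0 r := filter_subset _ _

theorem mem_ascents {X : Type*} [Preorder X] [DecidableLT X] {r : ℕ} (i : Fin r → X)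
    {a b : Fin r} (hab : (b : ℕ) = a + 1) : (b : ℕ) ∈ ascents i ↔ i a < i b := by
  rw [ascents, mem_filter, mem_Ioo]
  constructor
  · rintro ⟨-, a', b', h1, h2, h3⟩
    obtain rfl : b' = b := Fin.ext h2
    obtain rfl : a' = a := Fin.ext (by omega)
    exact h3
  · exact fun h => ⟨⟨by omega, b.is_lt⟩, a, b, hab, rfl, h⟩

theorem isWord_iff {X : Type*} [Preorder X] [DecidableLT X] {r : ℕ} {S : Finset ℕ}
    (hS : S ⊆ Ioo 0 r) (i : Fin r → X) : IsWord S i ↔ Monotone i ∧ S ⊆ ascents i := by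
  refine and_congr_right fun _ => ⟨fun h t ht => ?_, fun h a b hab hb => ?_⟩
  · obtain ⟨h0, h1⟩ := mem_Ioo.1 (hS ht)
    exact (mem_ascents i (a := ⟨t - 1, by omega⟩) (b := ⟨t, h1⟩) (by simp; omega)).2
      (h _ _ (by simp; omega) ht)
  · exact (mem_ascents i hab).1 (h hb)

/-- Words with the same ascents have the same strict comparisons. -/
theorem lt_iff_of_ascents_eq {X Y : Type*} [LinearOrder X] [LinearOrder Y] {r : ℕ}
    {i : Fin r → X} {i' : Fin r → Y} (hi : Monotone i) (hi' : Monotone i')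
    (h : ascents i = ascents i') (a b : Fin r) : i a < i b ↔ i' a < i' b := by
  suffices H : ∀ n : ℕ, ∀ a b : Fin r, (b : ℕ) = a + n → (i a < i b ↔ i' a < i' b) by
    rcases le_total a b with hab | hab
    · exact H (b - a) a b (by rw [Fin.le_def] at hab; omega)
    · exact iff_of_false (hi hab).not_gt (hi' hab).not_gt
  intro n
  induction n with
  | zero =>
    intro a b hab
    obtain rfl : b = a := Fin.ext hab
    simp
  | succ n ih =>
    intro a b hab
    let c : Fin r := ⟨a + n, by omega⟩
    have hac : a ≤ c := by simp [Fin.le_def, c]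
    have hcb : c ≤ b := by simp [Fin.le_def, c]; omega
    have h1 := ih a c rfl
    have h2 : i c < i b ↔ i' c < i' b := by
      rw [← mem_ascents i (a := c) (b := b) (by simp [c]; omega), h, mem_ascents]
      simp [c]; omega
    constructor
    · intro hlt
      rcases (hi hac).lt_or_eq with hlt' | heq
      · exact (h1.1 hlt').trans_le (hi' hcb)
      · exact (hi' hac).trans_lt (h2.1 (heq ▸ hlt))
    · intro hlt
      rcases (hi' hac).lt_or_eq with hlt' | heq
      · exact (h1.2 hlt').trans_le (hi hcb)
      · exact (hi hac).trans_lt (h2.2 (heq ▸ hlt))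

/-- The exponent of the monomial of a word. -/
def content {X : Type*} {r : ℕ} (i : Fin r → X) : X →₀ ℕ := ∑ a, Finsupp.single (i a) 1

theorem degree_content {X : Type*} {r : ℕ} (i : Fin r → X) : (content i).degree = r := by
  simp [content, map_sum, Finsupp.degree_single]

/-- Quasisymmetry in terms of words. -/
theorem exists_common_exponents {X : Type*} [LinearOrder X] {r : ℕ} {i i' : Fin r → X}
    (hi : Monotone i) (hi' : Monotone i') (h : ascents i = ascents i') :
    ∃ (l : ℕ) (α : Fin l → ℕ) (ι ι' : Fin l → X), (∀ j, 0 < α j) ∧ StrictMono ι ∧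
      StrictMono ι' ∧ content i = ∑ j, Finsupp.single (ι j) (α j) ∧
      content i' = ∑ j, Finsupp.single (ι' j) (α j) := by
  classical
  have hlt := lt_iff_of_ascents_eq hi hi' h
  have heq : ∀ a b, i a = i b ↔ i' a = i' b := fun a b => by
    simp only [le_antisymm_iff, ← not_lt, hlt]
  -- `s` is the set of letters used, `σ` picks a position carrying each letter, `τ` sends a position
  -- to the rank of its letter. The exponents are the fibre sizes of `τ`, which serve both words
  -- because they have the same equalities.
  let s := univ.image i
  let ι : Fin #s → X := s.orderEmbOfFin rfl
  have hmem : ∀ j, ∃ a, i a = ι j := fun j => by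
    obtain ⟨a, -, ha⟩ := mem_image.1 (s.orderEmbOfFin_mem rfl j)
    exact ⟨a, ha⟩
  choose σ hσ using hmem
  have hrange : ∀ a, ∃ j, ι j = i a := fun a => by
    have : i a ∈ Set.range (s.orderEmbOfFin rfl) := by simp [s]
    exact this
  choose τ hτ using hrange
  have hστ : ∀ a, i (σ (τ a)) = i a := fun a => (hσ _).trans (hτ a)
  have hι : StrictMono ι := (s.orderEmbOfFin rfl).strictMono
  have hτσ : ∀ j, τ (σ j) = j := fun j => hι.injective ((hτ _).trans (hσ j))
  refine ⟨#s, fun j => #{a | τ a = j}, ι, fun j => i' (σ j), fun j => ?_, hι, ?_, ?_, ?_⟩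
  · exact card_pos.2 ⟨σ j, by simp [hτσ]⟩
  · intro j j' hjj
    rw [← hlt, hσ, hσ]
    exact hι hjj
  · rw [content, ← sum_fiberwise_of_maps_to (g := τ) (t := univ) (fun a _ => mem_univ _)]
    refine sum_congr rfl fun j _ => ?_
    rw [sum_congr rfl (g := fun _ => Finsupp.single (ι j) 1)]
    · simp
    · intro a ha
      rw [← hτ a, (mem_filter.1 ha).2]
  · rw [content, ← sum_fiberwise_of_maps_to (g := τ) (t := univ) (fun a _ => mem_univ _)]
    refine sum_congr rfl fun j _ => ?_
    rw [sum_congr rfl (g := fun _ => Finsupp.single (i' (σ j)) 1)]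
    · simp
    · intro a ha
      rw [← (heq _ _).1 (hστ a), (mem_filter.1 ha).2]

/-- Möbius inversion on the lattice of subsets; the recursion over proper subsets avoids an explicit
signed formula. -/
theorem exists_sum_powerset {G : Type*} [AddCommGroup G] (γ : Finset ℕ → G) :
    ∃ c : Finset ℕ → G, ∀ S, γ S = ∑ T ∈ S.powerset, c T := by
  classical
  let c : Finset ℕ → G := Finset.strongInduction fun S ih =>
    γ S - ∑ T ∈ S.ssubsets.attach, ih T (mem_ssubsets.1 T.2)
  refine ⟨c, fun S => ?_⟩
  have h : c S = γ S - ∑ T ∈ S.ssubsets, c T := by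
    rw [← sum_attach]
    exact Finset.strongInduction_eq _ S
  rw [← add_sum_erase _ _ (mem_powerset_self S), h]
  exact (sub_add_cancel _ _).symm

theorem content_toMultiset {X : Type*} {r : ℕ} (i : Fin r → X) :
    Finsupp.toMultiset (content i) = (List.ofFn i : Multiset X) := by
  rw [content, map_sum]
  simp only [Finsupp.toMultiset_single, one_smul]
  rw [← Multiset.sum_map_singleton (List.ofFn i : Multiset X)]
  simp [List.sum_ofFn, List.map_ofFn]

/-- Sorting the multiset of letters gives the word. Hence monomials of degree `r` correspond to
weakly increasing words of length `r`. -/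
theorem exists_unique_monotone_content {X : Type*} [LinearOrder X] {r : ℕ} {e : X →₀ ℕ}
    (he : e.degree = r) : ∃! i : Fin r → X, Monotone i ∧ content i = e := by
  have hL : ((Finsupp.toMultiset e).sort (· ≤ ·)).length = r := by
    rw [Multiset.length_sort, Finsupp.card_toMultiset, ← he]
    rfl
  subst hL
  refine ⟨((Finsupp.toMultiset e).sort (· ≤ ·)).get, ⟨?_, ?_⟩, ?_⟩
  · exact (Multiset.pairwise_sort _ _).sortedLE.monotone_get
  · apply Multiset.toFinsupp.symm.injective
    change Finsupp.toMultiset _ = Finsupp.toMultiset _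
    rw [content_toMultiset, List.ofFn_get, Multiset.sort_eq]
  · rintro i ⟨hi, hie⟩
    apply List.ofFn_injective
    rw [List.ofFn_get]
    refine List.Perm.eq_of_sortedLE hi.sortedLE_ofFn (Multiset.pairwise_sort _ _).sortedLE ?_
    rw [← Multiset.coe_eq_coe, ← content_toMultiset, hie, Multiset.sort_eq]

theorem eq_sum_words {k : Type*} [Field k] {m r : ℕ} {p : MvPolynomial (Fin m) k}
    (hp : p.IsHomogeneous r) :
    p = ∑ i : Fin r → Fin m with Monotone i,
      MvPolynomial.C (p.coeff (content i)) * ∏ a, MvPolynomial.X (i a) := by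
  classical
  have hmon : ∀ i : Fin r → Fin m,
      (∏ a, MvPolynomial.X (i a) : MvPolynomial (Fin m) k) =
        MvPolynomial.monomial (content i) 1 := by
    intro i
    rw [content, MvPolynomial.monomial_sum_one]
    rfl
  ext e
  simp only [hmon, MvPolynomial.coeff_sum, MvPolynomial.coeff_C_mul, MvPolynomial.coeff_monomial,
    mul_ite, mul_one, mul_zero]
  by_cases he : e.degree = r
  · obtain ⟨i, ⟨hi, hie⟩, huniq⟩ := exists_unique_monotone_content he
    rw [sum_eq_single_of_mem i (by simpa using hi)]
    · simp [hie]
    · intro i' hi' hne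
      rw [if_neg]
      exact fun h => hne (huniq i' ⟨by simpa using hi', h⟩)
  · rw [hp.coeff_eq_zero he, sum_eq_zero]
    intro i _
    rw [if_neg]
    rintro rfl
    exact he (degree_content i)

/-- A homogeneous polynomial whose coefficients depend only on the ascents of the words is a
combination of fundamental quasisymmetric polynomials, with coefficients which depend only on the
coefficients of the polynomial. -/
theorem aeval_eq_sum_fundEval {k A : Type*} [Field k] [CommRing A] [Algebra k A] {m r : ℕ}
    {p : MvPolynomial (Fin m) k} (hp : p.IsHomogeneous r) {γ c : Finset ℕ → k}
    (hγ : ∀ i : Fin r → Fin m, Monotone i → p.coeff (content i) = γ (ascents i))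
    (hc : ∀ S, γ S = ∑ T ∈ S.powerset, c T) (x : ℕ → A) :
    MvPolynomial.aeval (fun i : Fin m => x i) p =
      ∑ T ∈ (Ioo 0 r).powerset, c T • fundEval x (insert 0 T) r m := by
  classical
  conv_lhs => rw [eq_sum_words hp]
  simp only [map_sum, map_mul, map_prod, MvPolynomial.aeval_X, MvPolynomial.aeval_C]
  have h0 : ∀ T, fundEval x (insert 0 T) r m = fundEval x T r m := by
    intro T
    rw [fundEval_eq_sum, fundEval_eq_sum]
    refine sum_congr (filter_congr fun i _ => and_congr_right fun _ => ?_) fun _ _ => rfl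
    refine forall₂_congr fun a b => forall_congr' fun hab => ?_
    rw [mem_insert, or_iff_right (by omega)]
  -- A weakly increasing word contributes to `F_T` exactly when `T` is contained in its ascent set,
  -- so after exchanging the sums its total coefficient is `∑ c T` over such `T`, which is `γ` of
  -- the ascent set.
  have h1 : ∀ T ∈ (Ioo 0 r).powerset, c T • fundEval x (insert 0 T) r m =
      ∑ i : Fin r → Fin m with Monotone i, if T ⊆ ascents i then c T • ∏ a, x (i a) else 0 := by
    intro T hT
    rw [h0, fundEval_eq_sum, smul_sum, ← sum_filter, filter_filter]
    refine sum_congr (filter_congr fun i _ => isWord_iff (mem_powerset.1 hT) i) fun _ _ => rfl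
  rw [sum_congr rfl h1, sum_comm]
  refine sum_congr rfl fun i hi => ?_
  rw [hγ i (by simpa using hi), hc, ← sum_filter, ← Algebra.smul_def, sum_smul]
  refine sum_congr ?_ fun _ _ => rfl
  ext T
  simp only [mem_filter, mem_powerset]
  exact ⟨fun h => ⟨h.trans (ascents_subset i), h⟩, fun h => h.2⟩

/-- The coefficients of a quasisymmetric function depend only on the ascents. -/
theorem exists_coeff_of_ascents {k X : Type*} [Zero k] [LinearOrder X] (r : ℕ) (f : (X →₀ ℕ) → k)
    (hf : ∀ (l : ℕ) (α : Fin l → ℕ), (∀ j, 0 < α j) →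
      ∀ i i' : Fin l → X, StrictMono i → StrictMono i' →
        f (∑ j, Finsupp.single (i j) (α j)) = f (∑ j, Finsupp.single (i' j) (α j))) :
    ∃ γ : Finset ℕ → k, ∀ i : Fin r → X, Monotone i → f (content i) = γ (ascents i) := by
  classical
  -- `γ S` is read off from any word with ascent set `S`; the value `0` is a dummy for sets that no
  -- word over `X` realizes.
  refine ⟨fun S => if h : ∃ i : Fin r → X, Monotone i ∧ ascents i = S then f (content h.choose)
    else 0, fun i hi => ?_⟩
  have h : ∃ i' : Fin r → X, Monotone i' ∧ ascents i' = ascents i := ⟨i, hi, rfl⟩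
  simp only [dif_pos h]
  obtain ⟨l, α, ι, ι', h0, h1, h2, h3, h4⟩ :=
    exists_common_exponents hi h.choose_spec.1 h.choose_spec.2.symm
  rw [h3, h4]
  exact hf l α h0 ι ι' h1 h2

theorem IsQuasisymmetricPoly.exists_fundEval {k : Type*} [Field k] {m r : ℕ}
    {p : MvPolynomial (Fin m) k} (hq : IsQuasisymmetricPoly p) (hp : p.IsHomogeneous r) :
    ∃ c : Finset ℕ → k, ∀ {A : Type*} [CommRing A] [Algebra k A] (x : ℕ → A),
      MvPolynomial.aeval (fun i : Fin m => x i) p =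
        ∑ T ∈ (Ioo 0 r).powerset, c T • fundEval x (insert 0 T) r m := by
  obtain ⟨γ, hγ⟩ := exists_coeff_of_ascents r (fun e => p.coeff e) hq
  obtain ⟨c, hc⟩ := exists_sum_powerset γ
  exact ⟨c, fun x => aeval_eq_sum_fundEval hp hγ hc x⟩

theorem isHomogeneous_truncate {k : Type*} [Field k] {f : MvPowerSeries ℕ k}
    (hf : IsQuasisymmetric f) {r : ℕ} (hr : f.IsHomogeneous r) (m : ℕ) :
    (truncate f m).IsHomogeneous r := by
  intro e he
  rw [coeff_truncate hf.bounded] at he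
  have h := hr he
  change Finsupp.weight 1 _ = r at h
  change Finsupp.weight 1 _ = r
  have hw : ∀ {σ : Type} (d : σ →₀ ℕ), Finsupp.weight (1 : σ → ℕ) d = d.degree := fun d => by
    rw [Finsupp.degree_eq_weight_one]
    rfl
  rwa [hw, Finsupp.degree_mapDomain, ← hw] at h

theorem isQuasisymmetricPoly_truncate {k : Type*} [Field k] {f : MvPowerSeries ℕ k}
    (hf : IsQuasisymmetric f) (m : ℕ) : IsQuasisymmetricPoly (truncate f m) := by
  intro l α hα i i' hi hi'
  rw [coeff_truncate hf.bounded, coeff_truncate hf.bounded]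
  simp only [Finsupp.mapDomain_finsetSum, Finsupp.mapDomain_single]
  exact hf.coeff_eq l α hα _ _ (fun _ _ h => hi h) (fun _ _ h => hi' h)

/-- The coefficients come from `f` itself, before truncation. One family `c` therefore serves all
`m`, as the comparison of the generating function with the symmetrizations requires. -/
theorem IsQuasisymmetric.exists_fundEval {k : Type*} [Field k] {f : MvPowerSeries ℕ k}
    (hf : IsQuasisymmetric f) {r : ℕ} (hr : f.IsHomogeneous r) :
    ∃ c : Finset ℕ → k, ∀ (m : ℕ) {A : Type*} [CommRing A] [Algebra k A] (x : ℕ → A),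
      MvPolynomial.aeval (fun i : Fin m => x i) (truncate f m) =
        ∑ T ∈ (Ioo 0 r).powerset, c T • fundEval x (insert 0 T) r m := by
  obtain ⟨γ, hγ⟩ := exists_coeff_of_ascents r (fun e => MvPowerSeries.coeff e f) hf.coeff_eq
  obtain ⟨c, hc⟩ := exists_sum_powerset γ
  refine ⟨c, fun m A _ _ x =>
    aeval_eq_sum_fundEval (isHomogeneous_truncate hf hr m) (γ := γ) (fun i hi => ?_) hc x⟩
  have := hγ (fun a => (i a : ℕ)) hi
  rw [coeff_truncate hf.bounded]
  convert this using 2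
  · simp [content, Finsupp.mapDomain_finsetSum, Finsupp.mapDomain_single]
  · ext t
    simp [ascents]

/-! ### Antisymmetrization -/

/-- The antisymmetrization `∑_w sgn(w) w(p)`. -/
def antisym (k : Type*) [Field k] (n : ℕ) : MvPolynomial (Fin n) k →ₗ[k] MvPolynomial (Fin n) k :=
  ∑ w : Equiv.Perm (Fin n), ((Equiv.Perm.sign w : ℤ) : k) • (MvPolynomial.rename w).toLinearMap

theorem antisym_apply {k : Type*} [Field k] {n : ℕ} (p : MvPolynomial (Fin n) k) :
    antisym k n p =
      ∑ w : Equiv.Perm (Fin n), ((Equiv.Perm.sign w : ℤ) : k) • MvPolynomial.rename w p := by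
  simp [antisym]

theorem antisym_rename {k : Type*} [Field k] {n : ℕ} (t : Equiv.Perm (Fin n))
    (p : MvPolynomial (Fin n) k) :
    antisym k n (MvPolynomial.rename t p) = ((Equiv.Perm.sign t : ℤ) : k) • antisym k n p := by
  rw [antisym_apply, antisym_apply, smul_sum]
  refine Fintype.sum_equiv (Equiv.mulRight t) _ _ fun w => ?_
  have ht : ((Equiv.Perm.sign t : ℤ) : k) * ((Equiv.Perm.sign t : ℤ) : k) = 1 := by
    rw [← Int.cast_mul, Int.units_coe_mul_self, Int.cast_one]
  rw [MvPolynomial.rename_rename, smul_smul, Equiv.coe_mulRight, Equiv.Perm.sign_mul]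
  push_cast
  rw [mul_left_comm, ht, mul_one]

theorem antisym_rename_of_symm {k : Type*} [Field k] {n : ℕ} {s : MvPolynomial (Fin n) k}
    (hs : ∀ w : Equiv.Perm (Fin n), MvPolynomial.rename w s = s) (p : MvPolynomial (Fin n) k) :
    antisym k n (s * p) = s * antisym k n p := by
  simp only [antisym_apply, map_mul, hs, mul_sum, mul_smul_comm]

theorem antisym_eq_zero_of_swap {k : Type*} [Field k] [CharZero k] {n : ℕ}
    {p : MvPolynomial (Fin n) k} {a b : Fin n} (hab : a ≠ b)
    (hp : MvPolynomial.rename (Equiv.swap a b) p = p) : antisym k n p = 0 := by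
  have h := antisym_rename (Equiv.swap a b) p
  rw [hp, Equiv.Perm.sign_swap hab] at h
  have h2 : antisym k n p + antisym k n p = 0 := by
    nth_rewrite 1 [h]
    simp
  rw [← two_smul k, smul_eq_zero] at h2
  exact h2.resolve_left two_ne_zero

theorem rename_swap_monomial {k : Type*} [Field k] {n : ℕ} {e : Fin n →₀ ℕ} {a b : Fin n}
    (hab : e a = e b) (c : k) :
    MvPolynomial.rename (Equiv.swap a b) (MvPolynomial.monomial e c) =
      MvPolynomial.monomial e c := by
  rw [MvPolynomial.rename_monomial]
  refine congrArg (fun d => MvPolynomial.monomial d c) (Finsupp.ext fun i => ?_)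
  conv_lhs => rw [← Equiv.swap_apply_self a b i]
  rw [Finsupp.mapDomain_apply (Equiv.swap a b).injective]
  rcases eq_or_ne i a with rfl | hia
  · simp [hab]
  rcases eq_or_ne i b with rfl | hib
  · simp [hab]
  rw [Equiv.swap_apply_of_ne_of_ne hia hib]

/-- Monomial by monomial, the product with `s` is fixed by a transposition, which may depend on the
monomial; its antisymmetrization equals its own negative. -/
theorem antisym_mul_eq_zero {k : Type*} [Field k] [CharZero k] {n d : ℕ}
    {s p : MvPolynomial (Fin n) k} (hp : p.IsHomogeneous d)
    (h : ∀ e : Fin n →₀ ℕ, e.degree = d → ∃ a b, a ≠ b ∧ e a = e b ∧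
      MvPolynomial.rename (Equiv.swap a b) s = s) : antisym k n (s * p) = 0 := by
  rw [p.as_sum, mul_sum, map_sum]
  refine sum_eq_zero fun e he => ?_
  have hd : e.degree = d := by
    by_contra hne
    exact (MvPolynomial.mem_support_iff.1 he) (hp.coeff_eq_zero hne)
  obtain ⟨a, b, hab, heab, hs⟩ := h e hd
  refine antisym_eq_zero_of_swap hab ?_
  rw [map_mul, hs, rename_swap_monomial heab]

/-! ### Sums of distinct natural numbers -/

theorem sum_range_card_le (t : Finset ℕ) : ∑ j ∈ range #t, j ≤ ∑ j ∈ t, j := by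
  induction t using Finset.induction_on_max with
  | empty => simp
  | insert a s hs ih =>
    have ha : a ∉ s := fun h => (hs a h).false
    rw [card_insert_of_notMem ha, sum_insert ha, sum_range_succ, add_comm]
    have : #s ≤ a := by
      simpa using card_le_card (fun x hx => mem_range.2 (hs x hx) : s ⊆ range a)
    omega

theorem sum_range_card_le_of_injOn {ι : Type*} {s : Finset ι} {e : ι → ℕ}
    (he : Set.InjOn e s) : ∑ j ∈ range #s, j ≤ ∑ a ∈ s, e a := by
  classical
  have := sum_range_card_le (s.image e)
  rwa [card_image_of_injOn he, sum_image he] at this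

/-- Distinct exponents with the least possible sum are a permutation of `0, …, n - 1`: removing a
value that is too large would leave the others with too small a sum. -/
theorem lt_card_of_injective {n : ℕ} {e : Fin n → ℕ} (he : Function.Injective e)
    (hsum : ∑ a, e a = ∑ j ∈ range n, j) (a : Fin n) : e a < n := by
  by_contra! h
  have h1 := sum_range_card_le_of_injOn (s := univ.erase a) he.injOn
  rw [card_erase_of_mem (mem_univ a), card_univ, Fintype.card_fin] at h1
  have h2 := add_sum_erase univ e (mem_univ a)
  obtain ⟨m, rfl⟩ : ∃ m, n = m + 1 := ⟨n - 1, by have := a.pos; omega⟩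
  rw [sum_range_succ] at hsum
  simp only [Nat.add_sub_cancel] at h1
  omega

/-! ### Products over pairs -/

/-- The product of the `q x_a - x_b` over a set of pairs `(a, b)`. -/
def pairProd {k : Type*} [Field k] (q : k) {n : ℕ} (P : Finset (Fin n × Fin n)) :
    MvPolynomial (Fin n) k :=
  ∏ p ∈ P, (MvPolynomial.C q * MvPolynomial.X p.1 - MvPolynomial.X p.2)

theorem isHomogeneous_pairProd {k : Type*} [Field k] (q : k) {n : ℕ}
    (P : Finset (Fin n × Fin n)) : (pairProd q P).IsHomogeneous #P := by
  have := MvPolynomial.IsHomogeneous.prod P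
    (fun p => (MvPolynomial.C q * MvPolynomial.X p.1 - MvPolynomial.X p.2 : MvPolynomial (Fin n) k))
    (fun _ => 1) fun p _ => by
      refine .sub ?_ (MvPolynomial.isHomogeneous_X _ _)
      simpa using (MvPolynomial.isHomogeneous_C (Fin n) q).mul (MvPolynomial.isHomogeneous_X k p.1)
  simpa [pairProd] using this

theorem rename_pairProd {k : Type*} [Field k] (q : k) {n : ℕ} {P : Finset (Fin n × Fin n)}
    (w : Equiv.Perm (Fin n)) (hw : ∀ p, p ∈ P ↔ (w p.1, w p.2) ∈ P) :
    MvPolynomial.rename w (pairProd q P) = pairProd q P := by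
  rw [pairProd, map_prod]
  refine prod_equiv (Equiv.prodCongr w w) hw fun p _ => ?_
  simp

/-- The pairs of indices in `[l, h)` which are at distance at least two. -/
def farPairs (n l h : ℕ) : Finset (Fin n × Fin n) :=
  {p | l ≤ (p.1 : ℕ) ∧ (p.1 : ℕ) + 1 < p.2 ∧ (p.2 : ℕ) < h}

theorem card_filter_fin_mem {n : ℕ} {T : Finset ℕ} (hT : T ⊆ range n) :
    #{a : Fin n | (a : ℕ) ∈ T} = #T := by
  refine card_bij (fun a _ => (a : ℕ)) (by simp) (fun a _ b _ h => Fin.ext h) fun b hb => ?_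
  exact ⟨⟨b, by simpa using hT hb⟩, by simpa using hb, rfl⟩

theorem sum_range_pred (m : ℕ) : ∑ c ∈ range m, (c - 1) + (m - 1) = ∑ c ∈ range m, c := by
  induction m with
  | zero => simp
  | succ m ih => rw [sum_range_succ, sum_range_succ]; omega

/-- The term `h - l - 1` counts the adjacent pairs, and the right-hand side counts all pairs in the
interval. -/
theorem card_farPairs {n l h : ℕ} (hh : h ≤ n) :
    #(farPairs n l h) + (h - l - 1) = ∑ c ∈ range (h - l), c := by
  rw [← sum_range_pred]
  congr 1
  rw [farPairs, card_filter, Fintype.sum_prod_type_right]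
  have : ∀ b : Fin n, (∑ a : Fin n, if l ≤ (a : ℕ) ∧ (a : ℕ) + 1 < b ∧ (b : ℕ) < h then 1 else 0) =
      (fun b : ℕ => if l ≤ b ∧ b < h then b - l - 1 else 0) b := by
    intro b
    rw [← card_filter]
    simp only
    split_ifs with hb
    · have := card_filter_fin_mem (n := n) (T := Ico l (b - 1)) (fun x hx => by
        simp at hx ⊢; omega)
      rw [Nat.card_Ico] at this
      rw [show (b : ℕ) - l - 1 = b - 1 - l by omega, ← this]
      congr 1
      ext a
      simp; omega
    · rw [card_eq_zero, filter_eq_empty_iff]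
      intro a _
      omega
  rw [sum_congr rfl fun b _ => this b, Fin.sum_univ_eq_sum_range
    (fun b : ℕ => if l ≤ b ∧ b < h then b - l - 1 else 0), ← sum_filter]
  have : {b ∈ range n | l ≤ b ∧ b < h} = Ico l h := by
    ext b
    simp; omega
  rw [this, sum_Ico_eq_sum_range]
  exact sum_congr rfl fun c _ => by omega

/-! ### The `q`-divided symmetrization as an antisymmetrization of polynomials -/

/-- The Vandermonde product `∏_{i < j} (x_i - x_j)`. -/
def vandermondeProd (k : Type*) [Field k] (n : ℕ) : MvPolynomial (Fin n) k :=
  ∏ i : Fin n, ∏ j ∈ Ioi i, (MvPolynomial.X i - MvPolynomial.X j)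

theorem vandermondeProd_ne_zero (k : Type*) [Field k] (n : ℕ) : vandermondeProd k n ≠ 0 := by
  refine prod_ne_zero_iff.2 fun i _ => prod_ne_zero_iff.2 fun j hj => sub_ne_zero.2 fun h => ?_
  exact (mem_Ioi.1 hj).ne (MvPolynomial.X_injective h)

theorem permAct_algebraMap {k : Type*} [Field k] {n : ℕ} (w : Equiv.Perm (Fin n))
    (p : MvPolynomial (Fin n) k) :
    permAct k w (algebraMap _ _ p) = algebraMap _ _ (MvPolynomial.rename w p) :=
  IsFractionRing.ringEquivOfRingEquiv_algebraMap _ _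

theorem algebraMap_C {k : Type*} [Field k] {n : ℕ} (c : k) :
    algebraMap (MvPolynomial (Fin n) k) (RatFun k n) (MvPolynomial.C c) =
      algebraMap k (RatFun k n) c := by
  rw [IsScalarTower.algebraMap_apply k (MvPolynomial (Fin n) k) (RatFun k n)]
  rfl

/-- The denominator consists of the factors at adjacent pairs and cancels against the full product,
leaving the pairs at distance at least two. -/
theorem qDS_eq {k : Type*} [Field k] (q : k) {n : ℕ} (f : MvPolynomial (Fin n) k) :
    qDS q f = algebraMap _ _ (antisym k n (pairProd q (farPairs n 0 n) * f)) /
      algebraMap _ (RatFun k n) (vandermondeProd k n) := by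
  classical
  have hfac : ∀ i j : Fin n, algebraMap k (RatFun k n) q * ratX k i - ratX k j =
      algebraMap _ _ (MvPolynomial.C q * MvPolynomial.X i - MvPolynomial.X j) := by
    intro i j
    rw [map_sub, map_mul, algebraMap_C]
    rfl
  have hne : ∀ i j : Fin n, i ≠ j →
      algebraMap k (RatFun k n) q * ratX k i - ratX k j ≠ 0 := by
    intro i j hij
    rw [hfac]
    refine (map_ne_zero_iff _ (IsFractionRing.injective (MvPolynomial (Fin n) k) _)).2 fun h => ?_
    have := congrArg (MvPolynomial.coeff (Finsupp.single j 1)) h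
    simp [MvPolynomial.coeff_C_mul, MvPolynomial.coeff_X, Finsupp.single_left_inj, hij] at this
  have hsplit : (∏ i : Fin n, ∏ j ∈ Ioi i, (algebraMap k (RatFun k n) q * ratX k i - ratX k j)) *
      (algebraMap (MvPolynomial (Fin n) k) (RatFun k n) f /
        ∏ i : Fin n, ∏ j ∈ univ.filter (fun j : Fin n => (j : ℕ) = (i : ℕ) + 1),
          (algebraMap k (RatFun k n) q * ratX k i - ratX k j)) =
      algebraMap _ _ (pairProd q (farPairs n 0 n) * f) := by
    have h1 : ∀ i : Fin n, ∏ j ∈ Ioi i, (algebraMap k (RatFun k n) q * ratX k i - ratX k j) =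
        (∏ j ∈ univ.filter (fun j : Fin n => (i : ℕ) + 1 < (j : ℕ)),
          (algebraMap k (RatFun k n) q * ratX k i - ratX k j)) *
        ∏ j ∈ univ.filter (fun j : Fin n => (j : ℕ) = (i : ℕ) + 1),
          (algebraMap k (RatFun k n) q * ratX k i - ratX k j) := by
      intro i
      rw [← prod_union]
      · congr 1
        ext j
        simp only [mem_Ioi, mem_union, mem_filter, mem_univ, true_and]
        omega
      · rw [disjoint_filter]
        intro j _ h
        omega
    have h2 : algebraMap _ (RatFun k n) (pairProd q (farPairs n 0 n)) =
        ∏ i : Fin n, ∏ j ∈ univ.filter (fun j : Fin n => (i : ℕ) + 1 < (j : ℕ)),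
          (algebraMap k (RatFun k n) q * ratX k i - ratX k j) := by
      rw [pairProd, map_prod]
      simp only [prod_filter, farPairs, Fintype.prod_prod_type, hfac]
      simp
    rw [prod_congr rfl fun i _ => h1 i, prod_mul_distrib, ← h2, map_mul, mul_assoc,
      mul_div_cancel₀]
    refine prod_ne_zero_iff.2 fun i _ => prod_ne_zero_iff.2 fun j hj => hne i j ?_
    rintro rfl
    simp at hj
  rw [qDS, squareLongest, partialLongest, hsplit, antisym_apply, map_sum]
  congr 1
  · refine sum_congr rfl fun w _ => ?_
    rw [permAct_algebraMap, MvPolynomial.smul_eq_C_mul, map_mul _ (MvPolynomial.C _), algebraMap_C,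
      map_intCast]
  · simp [vandermondeProd, map_prod, ratX]

/-! ### The Klyachko relations and the `q`-divided symmetrization -/

/-- The partial sum `x_1 + ⋯ + x_j` (all variables if `n ≤ j`). -/
def initSum (k : Type*) [Field k] (n j : ℕ) : MvPolynomial (Fin n) k :=
  ∑ a ∈ univ.filter (fun a : Fin n => (a : ℕ) < j), MvPolynomial.X a

theorem initSum_zero (k : Type*) [Field k] (n : ℕ) : initSum k n 0 = 0 := by
  simp [initSum]

theorem initSum_of_le (k : Type*) [Field k] {n j : ℕ} (h : n ≤ j) :
    initSum k n j = initSum k n n := by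
  refine sum_congr (filter_congr fun a _ => ?_) fun _ _ => rfl
  omega

theorem initSum_succ {k : Type*} [Field k] {n : ℕ} (j : Fin n) :
    initSum k n (j + 1) = initSum k n j + MvPolynomial.X j := by
  have : univ.filter (fun a : Fin n => (a : ℕ) < j + 1) =
      insert j (univ.filter fun a : Fin n => (a : ℕ) < j) := by
    ext a
    simp only [mem_insert, mem_filter, mem_univ, true_and, Fin.ext_iff]
    omega
  rw [initSum, this, sum_insert (by simp), add_comm]
  rfl

theorem isHomogeneous_initSum (k : Type*) [Field k] (n j : ℕ) :
    (initSum k n j).IsHomogeneous 1 :=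
  .sum _ _ _ fun _ _ => MvPolynomial.isHomogeneous_X _ _

theorem rename_initSum {k : Type*} [Field k] {n j : ℕ} (w : Equiv.Perm (Fin n))
    (hw : ∀ a : Fin n, (a : ℕ) < j ↔ (w a : ℕ) < j) :
    MvPolynomial.rename w (initSum k n j) = initSum k n j := by
  rw [initSum, map_sum]
  refine sum_equiv w (by simpa using hw) fun a _ => ?_
  simp

/-- If the exponents were distinct within each of the two blocks, of sizes `i` and `n - i`, each
block would contribute at least a triangular number to the degree. -/
theorem exists_eq_of_degree_lt {n i : ℕ} (hi : i ≤ n) {e : Fin n →₀ ℕ}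
    (h : e.degree < ∑ j ∈ range i, j + ∑ j ∈ range (n - i), j) :
    ∃ a b, a ≠ b ∧ e a = e b ∧ ((a : ℕ) < i ↔ (b : ℕ) < i) := by
  by_contra! hne
  refine h.not_ge ?_
  have hcard : #{a : Fin n | (a : ℕ) < i} = i := by
    simpa using card_filter_fin_mem (n := n) (T := range i) (range_subset_range.2 hi)
  have hcard' : #{a : Fin n | ¬ (a : ℕ) < i} = n - i := by
    have := card_filter_add_card_filter_not (s := (univ : Finset (Fin n))) (fun a => (a : ℕ) < i)
    rw [hcard, card_univ, Fintype.card_fin] at this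
    omega
  have h1 := sum_range_card_le_of_injOn (s := {a : Fin n | (a : ℕ) < i}) (e := e) (by
    intro a ha b hb hab
    by_contra hn
    have := hne a b hn hab
    simp only [coe_filter, mem_univ, true_and, Set.mem_ofPred_eq] at ha hb
    omega)
  have h2 := sum_range_card_le_of_injOn (s := {a : Fin n | ¬ (a : ℕ) < i}) (e := e) (by
    intro a ha b hb hab
    by_contra hn
    have := hne a b hn hab
    simp only [coe_filter, mem_univ, true_and, Set.mem_ofPred_eq] at ha hb
    omega)
  rw [hcard] at h1
  rw [hcard'] at h2
  rw [Finsupp.degree_eq_sum, ← sum_filter_add_sum_filter_not univ (fun a : Fin n => (a : ℕ) < i)]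
  exact add_le_add h1 h2

/-- The extra factor is the only adjacent pair that straddles the cut at `b`. It completes the
product over all straddling pairs, which is symmetric within each block, and the other pairs lie
inside one of the blocks. -/
theorem pairProd_farPairs_mul {k : Type*} [Field k] (q : k) {n : ℕ} {a b : Fin n}
    (hab : (b : ℕ) = a + 1) :
    pairProd q (farPairs n 0 n) * (MvPolynomial.C q * MvPolynomial.X a - MvPolynomial.X b) =
      pairProd q ({p | (p.1 : ℕ) < b ∧ ¬ (p.2 : ℕ) < b} : Finset (Fin n × Fin n)) *
        (pairProd q (farPairs n 0 b) * pairProd q (farPairs n b n)) := by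
  have h1 : pairProd q (farPairs n 0 n) *
      (MvPolynomial.C q * MvPolynomial.X a - MvPolynomial.X b) =
      pairProd q (insert (a, b) (farPairs n 0 n)) := by
    rw [pairProd, pairProd, prod_insert (by simp [farPairs]; omega), mul_comm]
  have hd1 : Disjoint (farPairs n 0 b) (farPairs n b n) := by
    rw [farPairs, farPairs, disjoint_filter]
    intro p _ h
    omega
  have hd2 : Disjoint ({p | (p.1 : ℕ) < b ∧ ¬ (p.2 : ℕ) < b} : Finset (Fin n × Fin n))
      (farPairs n 0 b ∪ farPairs n b n) := by
    rw [farPairs, farPairs, ← filter_or, disjoint_filter]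
    intro p _ h
    omega
  rw [h1, pairProd, pairProd, pairProd, pairProd, ← prod_union hd1, ← prod_union hd2]
  congr 1
  ext ⟨c, d⟩
  simp only [farPairs, mem_insert, mem_union, mem_filter, mem_univ, true_and, Prod.mk.injEq,
    Fin.ext_iff]
  omega

theorem swap_lt_iff {n i : ℕ} {a b : Fin n} (hab : (a : ℕ) < i ↔ (b : ℕ) < i) (c : Fin n) :
    (c : ℕ) < i ↔ (Equiv.swap a b c : ℕ) < i := by
  rw [Equiv.swap_apply_def]
  split_ifs with h1 h2
  · rw [h1, hab]
  · rw [h2, hab]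
  · rfl

section

variable {k : Type*} [Field k] [CharZero k] (q : k) {n : ℕ}

theorem antisym_farPairs_mul_eq_zero {d : ℕ} (hd : d + 1 < n) {h : MvPolynomial (Fin n) k}
    (hh : h.IsHomogeneous d) : antisym k n (pairProd q (farPairs n 0 n) * h) = 0 := by
  rw [← one_mul (_ * h)]
  refine antisym_mul_eq_zero ((isHomogeneous_pairProd q _).mul hh) fun e he => ?_
  have hc := card_farPairs (n := n) (l := 0) (h := n) le_rfl
  obtain ⟨a, b, hab, heab, -⟩ := exists_eq_of_degree_lt (i := 0) (e := e) (Nat.zero_le n) (by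
    rw [Nat.sub_zero] at hc ⊢
    rw [he, range_zero, sum_empty]
    omega)
  exact ⟨a, b, hab, heab, map_one _⟩

theorem antisym_farPairs_mul_sum {d : ℕ} (hd : d + 1 < n) {h : MvPolynomial (Fin n) k}
    (hh : h.IsHomogeneous d) :
    antisym k n (pairProd q (farPairs n 0 n) * (h * initSum k n n)) = 0 := by
  rw [← mul_assoc, mul_comm, antisym_rename_of_symm fun w => rename_initSum w (by simp),
    antisym_farPairs_mul_eq_zero q hd hh, mul_zero]

/-- The straddling product times `initSum k n b` is invariant under permutations within the two
blocks. The cofactor has degree less than the sum of the two triangular numbers, because each block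
lacks its adjacent pairs and `d + 2 < n`; so each of its monomials has equal exponents inside a
block. -/
theorem antisym_farPairs_mul_relation {d : ℕ} (hd : d + 2 < n) {h : MvPolynomial (Fin n) k}
    (hh : h.IsHomogeneous d) {a b : Fin n} (hab : (b : ℕ) = a + 1) :
    antisym k n (pairProd q (farPairs n 0 n) * (h * (initSum k n b *
      (MvPolynomial.C q * MvPolynomial.X a - MvPolynomial.X b)))) = 0 := by
  have h1 : pairProd q (farPairs n 0 n) * (h * (initSum k n b *
      (MvPolynomial.C q * MvPolynomial.X a - MvPolynomial.X b))) =
      (initSum k n b *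
        pairProd q ({p | (p.1 : ℕ) < b ∧ ¬ (p.2 : ℕ) < b} : Finset (Fin n × Fin n))) *
        (pairProd q (farPairs n 0 b) * pairProd q (farPairs n b n) * h) := by
    linear_combination h * initSum k n b * pairProd_farPairs_mul q hab
  rw [h1]
  refine antisym_mul_eq_zero
    (((isHomogeneous_pairProd q _).mul (isHomogeneous_pairProd q _)).mul hh) fun e he => ?_
  have hc := card_farPairs (n := n) (l := 0) (h := b) b.is_lt.le
  have hc' := card_farPairs (n := n) (l := b) (h := n) le_rfl
  obtain ⟨c, c', hcc, hec, hb⟩ := exists_eq_of_degree_lt (i := b) (e := e) b.is_lt.le (by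
    rw [Nat.sub_zero] at hc
    rw [he]
    have := b.is_lt
    omega)
  refine ⟨c, c', hcc, hec, ?_⟩
  rw [map_mul, rename_initSum _ (swap_lt_iff hb), rename_pairProd _ _ fun p => ?_]
  simp only [mem_filter, mem_univ, true_and]
  rw [← swap_lt_iff hb, ← swap_lt_iff hb]

end

/-- The ideal of the Klyachko relations in `k[x_1, …, x_n]`, with `u_i = x_1 + ⋯ + x_i`. -/
def relationIdeal {k : Type*} [Field k] (q : k) (n : ℕ) : Ideal (MvPolynomial (Fin n) k) :=
  Ideal.span ({initSum k n n} ∪ {g | ∃ a b : Fin n, (b : ℕ) = a + 1 ∧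
    g = initSum k n b * (MvPolynomial.C q * MvPolynomial.X a - MvPolynomial.X b)})

theorem antisym_homogeneousComponent_mul {k : Type*} [Field k] (q : k) {n r d : ℕ}
    {g : MvPolynomial (Fin n) k} (hg : g.IsHomogeneous d)
    (H : ∀ (t : ℕ) (h : MvPolynomial (Fin n) k), h.IsHomogeneous t → t + d = r →
      antisym k n (pairProd q (farPairs n 0 n) * (h * g)) = 0) (h : MvPolynomial (Fin n) k) :
    antisym k n (pairProd q (farPairs n 0 n) *
      MvPolynomial.homogeneousComponent r (h * g)) = 0 := by
  rw [← h.sum_homogeneousComponent, sum_mul, map_sum, mul_sum, map_sum]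
  refine sum_eq_zero fun t _ => ?_
  have ht := h.homogeneousComponent_isHomogeneous t
  rw [MvPolynomial.homogeneousComponent_of_mem
    ((MvPolynomial.mem_homogeneousSubmodule _ _).2 (ht.mul hg))]
  split_ifs with hr
  · exact H t _ ht hr.symm
  · simp

theorem antisym_eq_zero_of_mem_relationIdeal {k : Type*} [Field k] [CharZero k] (q : k) {r : ℕ}
    {f : MvPolynomial (Fin (r + 1)) k} (hf : f ∈ relationIdeal q (r + 1)) :
    antisym k (r + 1) (pairProd q (farPairs (r + 1) 0 (r + 1)) *
      MvPolynomial.homogeneousComponent r f) = 0 := by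
  -- Quantifying over all multiples makes the property stable under multiplication, as induction
  -- over the ideal requires.
  suffices H : ∀ h, antisym k (r + 1) (pairProd q (farPairs (r + 1) 0 (r + 1)) *
      MvPolynomial.homogeneousComponent r (h * f)) = 0 by simpa using H 1
  refine Submodule.span_induction (p := fun f _ => ∀ h, antisym k (r + 1)
    (pairProd q (farPairs (r + 1) 0 (r + 1)) * MvPolynomial.homogeneousComponent r (h * f)) = 0)
    ?_ ?_ ?_ ?_ hf
  · rintro g (rfl | ⟨a, b, hab, rfl⟩)
    · refine antisym_homogeneousComponent_mul q (isHomogeneous_initSum k _ _) ?_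
      intro t h hh ht
      exact antisym_farPairs_mul_sum q (by omega) hh
    · refine antisym_homogeneousComponent_mul q (d := 2) ?_ ?_
      · refine (isHomogeneous_initSum k _ _).mul (n := 1)
          (.sub ?_ (MvPolynomial.isHomogeneous_X _ _))
        simpa using (MvPolynomial.isHomogeneous_C _ q).mul (MvPolynomial.isHomogeneous_X k a)
      · intro t h hh ht
        exact antisym_farPairs_mul_relation q (by omega) hh hab
  · simp
  · intro x y _ _ hx hy h
    rw [mul_add, map_add, mul_add, map_add, hx, hy, add_zero]
  · intro c x _ hx h
    rw [smul_eq_mul, ← mul_assoc]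
    exact hx _

theorem antisym_mul_eq_zero_of_mem {k : Type*} [Field k] [CharZero k] (q : k) {r : ℕ}
    {f : MvPolynomial (Fin (r + 1)) k} (hf : f ∈ relationIdeal q (r + 1)) (hd : f.totalDegree ≤ r) :
    antisym k (r + 1) (pairProd q (farPairs (r + 1) 0 (r + 1)) * f) = 0 := by
  rw [← f.sum_homogeneousComponent, mul_sum, map_sum]
  refine sum_eq_zero fun d hdm => ?_
  rcases (show d ≤ r by simp at hdm; omega).lt_or_eq with hlt | rfl
  · exact antisym_farPairs_mul_eq_zero q (by omega) (f.homogeneousComponent_isHomogeneous d)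
  · exact antisym_eq_zero_of_mem_relationIdeal q hf

/-! ### Normalization -/

theorem antisym_monomial_eq_zero {k : Type*} [Field k] [CharZero k] {n : ℕ} {e : Fin n →₀ ℕ}
    (he : ¬ Function.Injective e) (c : k) : antisym k n (MvPolynomial.monomial e c) = 0 := by
  simp only [Function.Injective, not_forall] at he
  obtain ⟨a, b, hab, hne⟩ := he
  exact antisym_eq_zero_of_swap hne (rename_swap_monomial hab c)

theorem antisym_prod_X_pow {k : Type*} [Field k] {n : ℕ} (e : Fin n → ℕ) :
    antisym k n (∏ i, MvPolynomial.X i ^ e i) =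
      (Matrix.of fun i j : Fin n => (MvPolynomial.X i : MvPolynomial (Fin n) k) ^ e j).det := by
  rw [antisym_apply, Matrix.det_apply]
  refine sum_congr rfl fun w _ => ?_
  simp [map_prod, Units.smul_def, ← Int.cast_smul_eq_zsmul k]

theorem vandermondeProd_eq_det (k : Type*) [Field k] (n : ℕ) :
    vandermondeProd k n = (-1) ^ (∑ j ∈ range n, j) *
      (Matrix.vandermonde fun i : Fin n => (MvPolynomial.X i : MvPolynomial (Fin n) k)).det := by
  rw [Matrix.det_vandermonde, vandermondeProd]
  have h : ∀ i : Fin n,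
      ∏ j ∈ Ioi i, (MvPolynomial.X i - MvPolynomial.X j : MvPolynomial (Fin n) k) =
      (-1) ^ (n - 1 - (i : ℕ)) * ∏ j ∈ Ioi i, (MvPolynomial.X j - MvPolynomial.X i) := by
    intro i
    rw [← Fin.card_Ioi, ← prod_const, ← prod_mul_distrib]
    exact prod_congr rfl fun j _ => by ring
  rw [prod_congr rfl fun i _ => h i, prod_mul_distrib, prod_pow_eq_pow_sum,
    Fin.sum_univ_eq_sum_range (fun i => n - 1 - i), sum_range_reflect (fun i => i)]

/-- The exponents `r, 0, 1, …, r - 1` are a cyclic rotation of `0, …, r`, and this cycle has sign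
`(-1) ^ r`. -/
theorem det_X_pow_rotate (k : Type*) [Field k] (r : ℕ) :
    (Matrix.of fun i j : Fin (r + 1) => (MvPolynomial.X i : MvPolynomial (Fin (r + 1)) k) ^
      (if j = 0 then r else (j : ℕ) - 1)).det = (-1) ^ r *
      (Matrix.vandermonde fun i => (MvPolynomial.X i : MvPolynomial (Fin (r + 1)) k)).det := by
  have : (Matrix.vandermonde fun i => (MvPolynomial.X i : MvPolynomial (Fin (r + 1)) k)) =
      (Matrix.of fun i j : Fin (r + 1) => (MvPolynomial.X i : MvPolynomial (Fin (r + 1)) k) ^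
        (if j = 0 then r else (j : ℕ) - 1)).submatrix id (finRotate (r + 1)) := by
    ext1 i j
    rw [Matrix.submatrix_apply, Matrix.vandermonde_apply, Matrix.of_apply]
    congr 1
    induction j using Fin.lastCases with
    | last => simp
    | cast j =>
      rw [finRotate_apply, Fin.coeSucc_eq_succ]
      simp [Fin.succ_ne_zero]
  rw [this, Matrix.det_permute', sign_finRotate]
  push_cast
  rw [← mul_assoc, ← mul_pow]
  simp

/-- The exponent of the term of `x_1 ^ r ∏ (q x_a - x_b)` where `q x_a` is chosen for the pairs
in `B` is not injective unless `B` is empty. -/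
theorem not_injective_exponent {r : ℕ} {B : Finset (Fin (r + 1) × Fin (r + 1))}
    (hB : B ⊆ farPairs (r + 1) 0 (r + 1)) (hne : B.Nonempty) :
    ¬ Function.Injective fun c : Fin (r + 1) => #{p ∈ B | p.1 = c} +
      #{p ∈ farPairs (r + 1) 0 (r + 1) \ B | p.2 = c} + if c = 0 then r else 0 := by
  intro hinj
  set e : Fin (r + 1) → ℕ := fun c : Fin (r + 1) => #{p ∈ B | p.1 = c} +
      #{p ∈ farPairs (r + 1) 0 (r + 1) \ B | p.2 = c} + if c = 0 then r else 0 with he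
  have hsum : ∑ c, e c = ∑ j ∈ range (r + 1), j := by
    have hc := card_farPairs (n := r + 1) (l := 0) (h := r + 1) le_rfl
    have h1 := card_eq_sum_card_fiberwise (s := B) (f := Prod.fst) (t := univ) (by simp)
    have h2 := card_eq_sum_card_fiberwise (s := farPairs (r + 1) 0 (r + 1) \ B) (f := Prod.snd)
      (t := univ) (by simp)
    have h3 := card_sdiff_add_card_eq_card hB
    simp only [he, sum_add_distrib, ← h1, ← h2, sum_ite_eq', mem_univ, if_true]
    simp only [Nat.sub_zero, Nat.add_sub_cancel] at hc
    omega
  have hlt := lt_card_of_injective hinj hsum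
  -- With `a` minimal, no pair whose first entry is below `a` lies in `B`. This bounds the exponents
  -- from below and leaves too few indices for the values `0, …, a - 1`.
  obtain ⟨⟨a, b⟩, hab, hmin⟩ := exists_min_image B Prod.fst hne
  have hab' : (a : ℕ) + 1 < b := by
    have := hB hab
    simp only [farPairs, mem_filter] at this
    omega
  have hb := b.is_lt
  have ha1 : 1 ≤ #{p ∈ B | p.1 = a} := card_pos.2 ⟨(a, b), by simp [hab]⟩
  -- The pairs `(i, c)` with `i < a` and `i + 1 < c` are far and outside `B`, so each of them
  -- contributes to the exponent at `c`.
  have hge : ∀ c : Fin (r + 1), min (a : ℕ) (c - 1) ≤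
      #{p ∈ farPairs (r + 1) 0 (r + 1) \ B | p.2 = c} := by
    intro c
    have hT : #{i : Fin (r + 1) | (i : ℕ) ∈ range (min (a : ℕ) (c - 1))} = min (a : ℕ) (c - 1) := by
      rw [card_filter_fin_mem, card_range]
      intro x hx
      simp at hx ⊢; omega
    rw [← hT]
    refine card_le_card_of_injOn (fun i => (i, c)) ?_ (by intro x _ y _ h; simpa using h)
    intro i hi
    simp only [coe_filter, mem_univ, mem_range, true_and, Set.mem_ofPred_eq] at hi
    simp only [coe_filter, mem_sdiff, Set.mem_ofPred_eq, and_true, farPairs, mem_filter, mem_univ,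
      true_and]
    refine ⟨by omega, fun hmem => ?_⟩
    have := hmin _ hmem
    rw [Fin.le_def] at this
    simp only at this
    omega
  have h0 : r ≤ e 0 := by simp [he]
  have hea : 1 + min (a : ℕ) (a - 1) ≤ e a := by
    have := hge a
    simp only [he]
    omega
  rcases Nat.eq_zero_or_pos (a : ℕ) with ha | ha
  · have ha0 : a = 0 := Fin.ext ha
    have := hlt a
    simp only [he, ha0, if_true] at this ha1
    omega
  have hsurj : ∀ t < r + 1, ∃ c, e c = t := by
    intro t ht
    have : Function.Injective fun c => (⟨e c, hlt c⟩ : Fin (r + 1)) := fun c d h =>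
      hinj (Fin.mk.inj h)
    obtain ⟨c, hc⟩ := (Finite.injective_iff_surjective.1 this) ⟨t, ht⟩
    exact ⟨c, Fin.mk.inj hc⟩
  have hT : #{c : Fin (r + 1) | (c : ℕ) ∈ Ico 1 (a : ℕ)} = a - 1 := by
    rw [card_filter_fin_mem, Nat.card_Ico]
    intro x hx
    simp at hx ⊢; omega
  -- The exponents at `0`, at `a` and beyond `a` are all at least `a`, so the `a` values below `a`
  -- would have to be taken on the `a - 1` indices between `0` and `a`.
  have hsub : range a ⊆ image e {c : Fin (r + 1) | (c : ℕ) ∈ Ico 1 (a : ℕ)} := by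
    intro t ht
    rw [mem_range] at ht
    obtain ⟨c, hc⟩ := hsurj t (by omega)
    refine mem_image.2 ⟨c, ?_, hc⟩
    have hc0 : c ≠ 0 := by
      rintro rfl
      omega
    have hc1 : (c : ℕ) ≠ 0 := fun h => hc0 (Fin.ext h)
    simp only [mem_filter, mem_univ, true_and, mem_Ico]
    refine ⟨by omega, ?_⟩
    by_contra! hca
    have h1 := hge c
    rcases hca.lt_or_eq with hlt' | heq
    · have : #{p ∈ farPairs (r + 1) 0 (r + 1) \ B | p.2 = c} ≤ e c := by
        simp only [he]; omega
      omega
    · obtain rfl : a = c := Fin.ext heq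
      omega
  have := (card_le_card hsub).trans card_image_le
  rw [card_range, hT] at this
  omega

/-- Expand the product by choosing `q x_a` for the pairs in `B` and `-x_b` for the others. By
`not_injective_exponent` only `B = ∅` survives, so `q` disappears and a rotated Vandermonde
determinant is left. -/
theorem antisym_X_zero_pow {k : Type*} [Field k] [CharZero k] (q : k) (r : ℕ) :
    antisym k (r + 1) (pairProd q (farPairs (r + 1) 0 (r + 1)) * MvPolynomial.X 0 ^ r) =
      vandermondeProd k (r + 1) := by
  classical
  set P := farPairs (r + 1) 0 (r + 1) with hP
  have hX : ∀ c : Fin (r + 1), (MvPolynomial.X c : MvPolynomial (Fin (r + 1)) k) =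
      MvPolynomial.monomial (Finsupp.single c 1) 1 := fun _ => rfl
  have hterm : ∀ B ∈ P.powerset, B ≠ ∅ → antisym k (r + 1)
      ((∏ p ∈ B, MvPolynomial.C q * MvPolynomial.X p.1) *
        (∏ p ∈ P \ B, -MvPolynomial.X p.2) * MvPolynomial.X 0 ^ r) = 0 := by
    intro B hB hne
    have h1 : (∏ p ∈ B, MvPolynomial.C q * MvPolynomial.X p.1) *
        (∏ p ∈ P \ B, -MvPolynomial.X p.2) * MvPolynomial.X 0 ^ r =
        (q ^ #B * (-1) ^ #(P \ B)) • (MvPolynomial.monomial (∑ p ∈ B, Finsupp.single p.1 1 +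
          ∑ p ∈ P \ B, Finsupp.single p.2 1 + Finsupp.single (0 : Fin (r + 1)) r) (1 : k)) := by
      have h3 : ∏ p ∈ P \ B, -(MvPolynomial.X p.2 : MvPolynomial (Fin (r + 1)) k) =
          (-1) ^ #(P \ B) * ∏ p ∈ P \ B, MvPolynomial.X p.2 := by
        rw [← prod_const, ← prod_mul_distrib]
        exact prod_congr rfl fun _ _ => (neg_one_mul _).symm
      have h4 : (MvPolynomial.X 0 : MvPolynomial (Fin (r + 1)) k) ^ r =
          MvPolynomial.monomial (Finsupp.single 0 r) 1 := MvPolynomial.X_pow_eq_monomial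
      have h5 : ∀ d e : Fin (r + 1) →₀ ℕ, (MvPolynomial.monomial (d + e) 1 : MvPolynomial _ k) =
          MvPolynomial.monomial d 1 * MvPolynomial.monomial e 1 := by
        intro d e
        rw [MvPolynomial.monomial_mul, one_mul]
      rw [prod_mul_distrib, prod_const, h3, h4, h5, h5, MvPolynomial.monomial_sum_one,
        MvPolynomial.monomial_sum_one, MvPolynomial.smul_eq_C_mul]
      simp only [← hX, map_mul, map_pow, map_neg, map_one]
      ring
    rw [h1, map_smul, antisym_monomial_eq_zero, smul_zero]
    have := not_injective_exponent (mem_powerset.1 hB) (nonempty_iff_ne_empty.2 hne)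
    convert this using 2
    ext c
    simp only [Finsupp.add_apply, Finsupp.finsetSum_apply, Finsupp.single_apply, card_filter,
      eq_comm (a := c), hP]
  have hmain : (∏ p ∈ P, -(MvPolynomial.X p.2 : MvPolynomial (Fin (r + 1)) k)) *
      MvPolynomial.X 0 ^ r = (-1 : k) ^ #P •
        ∏ i : Fin (r + 1), MvPolynomial.X i ^ (if i = 0 then r else (i : ℕ) - 1) := by
    have h1 : ∏ p ∈ P, (MvPolynomial.X p.2 : MvPolynomial (Fin (r + 1)) k) =
        ∏ i : Fin (r + 1), MvPolynomial.X i ^ ((i : ℕ) - 1) := by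
      rw [← prod_fiberwise_of_maps_to (g := Prod.snd) (t := univ) (fun _ _ => mem_univ _)]
      refine prod_congr rfl fun i _ => ?_
      rw [prod_congr rfl (g := fun _ => MvPolynomial.X i) fun p hp => by rw [(mem_filter.1 hp).2],
        prod_const]
      congr 1
      have hT : #{c : Fin (r + 1) | (c : ℕ) ∈ range ((i : ℕ) - 1)} = i - 1 := by
        rw [card_filter_fin_mem, card_range]
        intro x hx
        simp at hx ⊢; omega
      rw [← hT]
      refine card_bij' (fun p _ => p.1) (fun c _ => (c, i)) ?_ ?_ ?_ ?_
      · rintro ⟨c, d⟩ h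
        simp [hP, farPairs] at h ⊢
        omega
      · intro c h
        simp [hP, farPairs] at h ⊢
        omega
      · rintro ⟨c, d⟩ h
        simp at h ⊢
        exact h.2.symm
      · intro c h
        rfl
    have h2 : ∏ p ∈ P, -(MvPolynomial.X p.2 : MvPolynomial (Fin (r + 1)) k) =
        (-1) ^ #P * ∏ p ∈ P, MvPolynomial.X p.2 := by
      rw [← prod_const, ← prod_mul_distrib]
      exact prod_congr rfl fun _ _ => (neg_one_mul _).symm
    rw [h2, h1, MvPolynomial.smul_eq_C_mul, Fin.prod_univ_succ, Fin.prod_univ_succ]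
    simp [Fin.succ_ne_zero]
    ring
  have hexp : pairProd q P = ∑ B ∈ P.powerset,
      (∏ p ∈ B, MvPolynomial.C q * MvPolynomial.X p.1) * ∏ p ∈ P \ B, -MvPolynomial.X p.2 := by
    rw [pairProd, ← prod_add]
    exact prod_congr rfl fun _ _ => sub_eq_add_neg _ _
  rw [hexp, sum_mul, map_sum, sum_eq_single_of_mem ∅ (empty_mem_powerset P) hterm, prod_empty,
    one_mul, sdiff_empty, hmain, map_smul, antisym_prod_X_pow, det_X_pow_rotate,
    vandermondeProd_eq_det, MvPolynomial.smul_eq_C_mul, ← mul_assoc]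
  congr 1
  have hc := card_farPairs (n := r + 1) (l := 0) (h := r + 1) le_rfl
  simp only [Nat.sub_zero, Nat.add_sub_cancel] at hc
  -- The signs agree: far pairs together with the `r` adjacent pairs are all pairs.
  rw [← hc, pow_add]
  simp [hP]

theorem qDS_eq_of_sub_mem {k : Type*} [Field k] [CharZero k] (q : k) {r : ℕ}
    {p : MvPolynomial (Fin (r + 1)) k} {c : k} (hp : p.totalDegree ≤ r)
    (h : p - MvPolynomial.C c * MvPolynomial.X 0 ^ r ∈ relationIdeal q (r + 1)) :
    qDS q p = algebraMap k (RatFun k (r + 1)) c := by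
  have hd : (p - MvPolynomial.C c * MvPolynomial.X 0 ^ r).totalDegree ≤ r := by
    refine (MvPolynomial.totalDegree_sub _ _).trans (max_le hp ?_)
    refine (MvPolynomial.totalDegree_mul _ _).trans ?_
    rw [MvPolynomial.totalDegree_C, MvPolynomial.totalDegree_X_pow, zero_add]
  have h0 := antisym_mul_eq_zero_of_mem q h hd
  rw [mul_sub, map_sub, sub_eq_zero] at h0
  rw [qDS_eq, h0, mul_left_comm, ← MvPolynomial.smul_eq_C_mul, map_smul, antisym_X_zero_pow,
    MvPolynomial.smul_eq_C_mul, map_mul, algebraMap_C, mul_div_cancel_right₀]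
  exact (map_ne_zero_iff _ (IsFractionRing.injective (MvPolynomial (Fin (r + 1)) k) _)).2
    (vandermondeProd_ne_zero k _)

/-! ### Consequences of the Klyachko relations -/

/-- If `[n]_q = 0` then `q ^ n = 1`, hence `q = 1` and `[n]_q = n`, which is nonzero in
characteristic zero. -/
theorem qFactorial_ne_zero {k : Type*} [Field k] [CharZero k] {q : k}
    (hq : ∀ n : ℕ, 0 < n → q ^ n = 1 → q = 1) (r : ℕ) : qFactorial q r ≠ 0 := by
  refine prod_ne_zero_iff.2 fun i _ h => ?_
  have h1 := geom_sum_mul q (i + 1)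
  rw [qInt] at h
  rw [h, zero_mul] at h1
  have hq1 := hq (i + 1) (Nat.succ_pos i) (sub_eq_zero.1 h1.symm)
  rw [hq1] at h
  simp only [one_pow, sum_const, card_range, nsmul_eq_mul, mul_one] at h
  exact Nat.cast_ne_zero.2 (Nat.succ_ne_zero i) h

section Algebra

variable {k A : Type*} [Field k] [CharZero k] [CommRing A] [Algebra k A] {q : k} {v : ℕ → A}

theorem fundEval_of_relations (hq : ∀ n : ℕ, 0 < n → q ^ n = 1 → q = 1) (h0 : v 0 = 0)
    (hrel : ∀ j, v (j + 1) * (v (j + 2) - v (j + 1)) =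
      algebraMap k A q * (v (j + 1) * (v (j + 1) - v j)))
    {S : Finset ℕ} (hS : 0 ∈ S) (r s : ℕ) :
    fundEval (fun j => v (j + 1) - v j) S r (numParts S r + s) =
      (q ^ descStat S r / qFactorial q r) • ∏ i ∈ range r, v (i + 1 + s) := by
  have h := qfact_mul_fundEval h0 hrel hS r s
  have hne := qFactorial_ne_zero hq r
  have hfac : (∏ i ∈ range r, ∑ j ∈ range (i + 1), algebraMap k A q ^ j) =
      algebraMap k A (qFactorial q r) := by
    simp [qFactorial, qInt]
  rw [hfac, ← map_pow, ← Algebra.smul_def, ← Algebra.smul_def] at h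
  rw [div_eq_inv_mul, mul_smul, ← h, smul_smul, inv_mul_cancel₀ hne, one_smul]

/-- With `m = numParts S r + s`, the two inequalities say that `n` lies in `[1 + s, r + s]`, so `v n
= 0` is a factor of the product. -/
theorem fundEval_eq_zero_of_relations (hq : ∀ n : ℕ, 0 < n → q ^ n = 1 → q = 1) (h0 : v 0 = 0)
    (hrel : ∀ j, v (j + 1) * (v (j + 2) - v (j + 1)) =
      algebraMap k A q * (v (j + 1) * (v (j + 1) - v j)))
    {S : Finset ℕ} (hS : 0 ∈ S) {r m n : ℕ} (hn : v n = 0)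
    (h1 : m < n + numParts S r) (h2 : n + numParts S r ≤ r + m) :
    fundEval (fun j => v (j + 1) - v j) S r m = 0 := by
  rcases lt_or_ge m (numParts S r) with hlt | hle
  · exact fundEval_eq_zero _ hlt
  · obtain ⟨s, rfl⟩ := Nat.exists_eq_add_of_le hle
    rw [fundEval_of_relations hq h0 hrel hS, prod_eq_zero (i := n - 1 - s), smul_zero]
    · rw [mem_range]
      omega
    · rwa [show n - 1 - s + 1 + s = n by omega]

theorem IsQuasisymmetricPoly.homogeneousComponent {k : Type*} [Field k] {n : ℕ}
    {p : MvPolynomial (Fin n) k} (hp : IsQuasisymmetricPoly p) (d : ℕ) :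
    IsQuasisymmetricPoly (MvPolynomial.homogeneousComponent d p) := by
  intro l α hα i i' hi hi'
  rw [MvPolynomial.coeff_homogeneousComponent, MvPolynomial.coeff_homogeneousComponent,
    hp l α hα i i' hi hi']
  simp [map_sum, Finsupp.degree_single]

/-- The kernel is an ideal, so generators suffice. In degree `d > 0` and `n` variables, a
composition has between `1` and `d` parts, which places `v n` among the factors. -/
theorem aeval_eq_zero_of_mem_qsymIdeal (hq : ∀ n : ℕ, 0 < n → q ^ n = 1 → q = 1) (h0 : v 0 = 0)
    (hrel : ∀ j, v (j + 1) * (v (j + 2) - v (j + 1)) =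
      algebraMap k A q * (v (j + 1) * (v (j + 1) - v j)))
    {n : ℕ} (hn : v n = 0) {f : MvPolynomial (Fin n) k} (hf : f ∈ qsymIdeal k n) :
    MvPolynomial.aeval (fun i : Fin n => v (i + 1) - v i) f = 0 := by
  suffices H : qsymIdeal k n ≤ RingHom.ker
      (MvPolynomial.aeval (R := k) (fun i : Fin n => v (i + 1) - v i)) from H hf
  refine Ideal.span_le.2 ?_
  rintro p ⟨hp, hp0⟩
  change MvPolynomial.aeval _ p = 0
  rw [← p.sum_homogeneousComponent, map_sum]
  refine sum_eq_zero fun d _ => ?_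
  rcases Nat.eq_zero_or_pos d with rfl | hd
  · rw [MvPolynomial.homogeneousComponent_zero, ← MvPolynomial.constantCoeff_eq, hp0]
    simp
  · obtain ⟨c, hc⟩ :=
      (hp.homogeneousComponent d).exists_fundEval (p.homogeneousComponent_isHomogeneous d)
    rw [hc fun j => v (j + 1) - v j]
    refine sum_eq_zero fun T _ => ?_
    have hpos := numParts_pos (mem_insert_self 0 T) hd
    have hle := numParts_le (insert 0 T) d
    rw [fundEval_eq_zero_of_relations hq h0 hrel (mem_insert_self 0 T) hn (by omega)
      (by omega), smul_zero]

end Algebra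

theorem numParts_singleton {r : ℕ} (hr : 0 < r) : numParts {0} r = 1 := by
  rw [numParts, card_eq_one]
  refine ⟨0, ?_⟩
  ext j
  simp only [mem_filter, mem_range, mem_singleton]
  omega

theorem descStat_singleton (r : ℕ) : descStat {0} r = 0 :=
  sum_eq_zero fun j _ => by rw [numParts_singleton (Nat.succ_pos j), Nat.sub_self]

theorem fundEval_singleton {A : Type*} [CommSemiring A] (x : ℕ → A) (r : ℕ) :
    fundEval x {0} r 1 = x 0 ^ r := by
  induction r with
  | zero => simp [fundEval]
  | succ r ih =>
    rw [fundEval, sum_range_one, pow_succ']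
    rcases Nat.eq_zero_or_pos r with rfl | hr
    · simp [fundEval]
    · simp [hr.ne', ih]

/-! ### Working modulo the relations -/

section Quotient

variable {k : Type*} [Field k] {q : k}

/-- For `j + 1 < n` this is a generator of the ideal; from there on the partial sum is the sum of
all variables, which is zero in the quotient. -/
theorem mk_initSum_relation (q : k) (n j : ℕ) :
    Ideal.Quotient.mk (relationIdeal q n) (initSum k n (j + 1)) *
      (Ideal.Quotient.mk (relationIdeal q n) (initSum k n (j + 2)) -
        Ideal.Quotient.mk (relationIdeal q n) (initSum k n (j + 1))) =
      algebraMap k _ q * (Ideal.Quotient.mk (relationIdeal q n) (initSum k n (j + 1)) *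
      (Ideal.Quotient.mk (relationIdeal q n) (initSum k n (j + 1)) -
        Ideal.Quotient.mk (relationIdeal q n) (initSum k n j))) := by
  rcases lt_or_ge (j + 1) n with hj | hj
  · let a : Fin n := ⟨j, by omega⟩
    let b : Fin n := ⟨j + 1, hj⟩
    have ha := initSum_succ (k := k) a
    have hb := initSum_succ (k := k) b
    have hmem : initSum k n (j + 1) *
        (MvPolynomial.C q * MvPolynomial.X a - MvPolynomial.X b) ∈ relationIdeal q n :=
      Ideal.subset_span (Or.inr ⟨a, b, rfl, rfl⟩)
    have h := Ideal.Quotient.eq_zero_iff_mem.2 hmem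
    have hC : algebraMap k (MvPolynomial (Fin n) k ⧸ relationIdeal q n) q =
      Ideal.Quotient.mk (relationIdeal q n) (MvPolynomial.C q) := rfl
    change initSum k n (j + 1) = initSum k n j + MvPolynomial.X a at ha
    change initSum k n (j + 2) = initSum k n (j + 1) + MvPolynomial.X b at hb
    have h1 := congrArg (Ideal.Quotient.mk (relationIdeal q n)) ha
    have h2 := congrArg (Ideal.Quotient.mk (relationIdeal q n)) hb
    rw [map_mul, map_sub, map_mul] at h
    rw [map_add] at h1 h2
    rw [hC, h2]
    nth_rewrite 5 [h1]
    linear_combination -h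
  · have : Ideal.Quotient.mk (relationIdeal q n) (initSum k n (j + 1)) = 0 := by
      rw [initSum_of_le k hj]
      exact Ideal.Quotient.eq_zero_iff_mem.2 (Ideal.subset_span (Or.inl rfl))
    rw [this]
    ring

theorem mk_initSum_of_le (q : k) {n j : ℕ} (hj : n ≤ j) :
    Ideal.Quotient.mk (relationIdeal q n) (initSum k n j) = 0 := by
  rw [initSum_of_le k hj]
  exact Ideal.Quotient.eq_zero_iff_mem.2 (Ideal.subset_span (Or.inl rfl))

theorem mk_X (q : k) {n : ℕ} (i : Fin n) :
    Ideal.Quotient.mk (relationIdeal q n) (initSum k n (i + 1)) -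
      Ideal.Quotient.mk (relationIdeal q n) (initSum k n i) =
      Ideal.Quotient.mk (relationIdeal q n) (MvPolynomial.X i) := by
  rw [initSum_succ, map_add, add_sub_cancel_left]

theorem mk_eq_aeval (q : k) {n : ℕ} (p : MvPolynomial (Fin n) k) :
    Ideal.Quotient.mk (relationIdeal q n) p = MvPolynomial.aeval (fun i : Fin n =>
      Ideal.Quotient.mk (relationIdeal q n) (initSum k n (i + 1)) -
      Ideal.Quotient.mk (relationIdeal q n) (initSum k n i)) p := by
  simp only [mk_X]
  exact DFunLike.congr_fun (MvPolynomial.aeval_unique (Ideal.Quotient.mkₐ k (relationIdeal q n))) p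

theorem mk_rename_eq_aeval (q : k) {n m : ℕ} (hm : m ≤ n) (p : MvPolynomial (Fin m) k) :
    Ideal.Quotient.mk (relationIdeal q n) (MvPolynomial.rename (Fin.castLE hm) p) =
      MvPolynomial.aeval (fun i : Fin m =>
      Ideal.Quotient.mk (relationIdeal q n) (initSum k n (i + 1)) -
      Ideal.Quotient.mk (relationIdeal q n) (initSum k n i)) p := by
  rw [mk_eq_aeval, MvPolynomial.aeval_rename]
  rfl

theorem mem_relationIdeal_of_mem_qsymIdeal [CharZero k]
    (hq : ∀ n : ℕ, 0 < n → q ^ n = 1 → q = 1) {n : ℕ}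
    {f : MvPolynomial (Fin n) k} (hf : f ∈ qsymIdeal k n) : f ∈ relationIdeal q n := by
  rw [← Ideal.Quotient.eq_zero_iff_mem, mk_eq_aeval]
  exact aeval_eq_zero_of_mem_qsymIdeal
    (v := fun j => Ideal.Quotient.mk (relationIdeal q n) (initSum k n j)) hq
    (by simp [initSum_zero]) (mk_initSum_relation q n) (mk_initSum_of_le q le_rfl) hf

/-- For `m = numParts S r` the value is a multiple of `u_1 ⋯ u_r`, as is `x_1 ^ r`, the fundamental
polynomial of the one-part composition (`S = {0}`) in one variable; comparing the two removes the
`q`-factorial. For larger `m` the product contains `u_{r+1} = 0`. -/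
theorem fundEval_mk [CharZero k] (hq : ∀ n : ℕ, 0 < n → q ^ n = 1 → q = 1)
    {S : Finset ℕ} (hS : 0 ∈ S)
    {r m : ℕ} (hr : 0 < r) (hm : m ≤ r + 1) :
    fundEval (fun j => Ideal.Quotient.mk (relationIdeal q (r + 1)) (initSum k (r + 1) (j + 1)) -
      Ideal.Quotient.mk (relationIdeal q (r + 1)) (initSum k (r + 1) j)) S r m =
      Ideal.Quotient.mk _ (MvPolynomial.C (if m = numParts S r then q ^ descStat S r else 0) *
        MvPolynomial.X 0 ^ r) := by
  set v := fun j => Ideal.Quotient.mk (relationIdeal q (r + 1)) (initSum k (r + 1) j) with hv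
  have h0 : v 0 = 0 := by simp [hv, initSum_zero]
  have hrel := mk_initSum_relation q (r + 1)
  split_ifs with h
  · have h1 := fundEval_of_relations hq h0 hrel hS r 0
    have h2 := fundEval_of_relations hq h0 hrel (mem_singleton_self 0) r 0
    rw [numParts_singleton hr, descStat_singleton, add_zero, fundEval_singleton] at h2
    have hX : v (0 + 1) - v 0 = Ideal.Quotient.mk _ (MvPolynomial.X 0) := mk_X q (0 : Fin (r + 1))
    rw [hX] at h2
    rw [add_zero, ← h] at h1
    refine h1.trans ?_
    rw [div_eq_mul_inv, mul_smul, inv_eq_one_div, ← pow_zero q, ← h2, ← map_pow,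
      ← MvPolynomial.smul_eq_C_mul]
    rfl
  · rw [map_zero, zero_mul, map_zero]
    have hpos := numParts_pos hS hr
    have hle := numParts_le S r
    rcases lt_or_ge m (numParts S r) with hlt | hge
    · exact fundEval_eq_zero _ hlt
    · exact fundEval_eq_zero_of_relations hq h0 hrel hS (n := r + 1)
        (mk_initSum_of_le q le_rfl) (by omega) (by omega)

theorem isHomogeneous_fundamental (k : Type*) [Field k] {d : ℕ} (α : Composition d) (m : ℕ) :
    (fundamental k α m).IsHomogeneous d := by
  classical
  refine .sum _ _ _ fun i _ => ?_
  have := MvPolynomial.IsHomogeneous.prod univ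
    (fun a => (MvPolynomial.X (i a) : MvPolynomial (Fin m) k)) (fun _ => 1)
    fun a _ => MvPolynomial.isHomogeneous_X _ _
  simpa using this

end Quotient

theorem qDS_rename_eq.{w} {k : Type w} [Field k] [CharZero k] {q : k}
    (hq : ∀ n : ℕ, 0 < n → q ^ n = 1 → q = 1) {r m : ℕ} (hr : 0 < r) (hm : m ≤ r + 1)
    {p : MvPolynomial (Fin m) k} (hp : p.IsHomogeneous r)
    {s : Finset (Finset ℕ)} {c : Finset ℕ → k}
    (h : ∀ {A : Type w} [CommRing A] [Algebra k A] (x : ℕ → A),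
      MvPolynomial.aeval (fun i : Fin m => x i) p = ∑ S ∈ s, c S • fundEval x (insert 0 S) r m) :
    qDS q (MvPolynomial.rename (Fin.castLE hm) p) = algebraMap k (RatFun k (r + 1))
      (∑ S ∈ s, c S * if m = numParts (insert 0 S) r then q ^ descStat (insert 0 S) r else 0) := by
  refine qDS_eq_of_sub_mem q ?_ ?_
  · exact (MvPolynomial.totalDegree_rename_le _ _).trans hp.totalDegree_le
  · rw [← Ideal.Quotient.eq, mk_rename_eq_aeval,
      h (A := MvPolynomial (Fin (r + 1)) k ⧸ relationIdeal q (r + 1)) fun j =>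
      Ideal.Quotient.mk (relationIdeal q (r + 1)) (initSum k (r + 1) (j + 1)) -
      Ideal.Quotient.mk (relationIdeal q (r + 1)) (initSum k (r + 1) j)]
    rw [map_sum, sum_mul, map_sum]
    refine sum_congr rfl fun S _ => ?_
    rw [fundEval_mk hq (mem_insert_self 0 S) hr hm, MvPolynomial.C_mul, mul_assoc,
      ← MvPolynomial.smul_eq_C_mul, ← MvPolynomial.smul_eq_C_mul]
    rfl

/-! ### The Klyachko algebras -/

theorem u_eq_zero {k : Type*} [Field k] (q : k) {I : Set ℤ} {i : ℤ} (hi : i ∉ I) :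
    u q I i = 0 :=
  Ideal.Quotient.eq_zero_iff_mem.2 (Ideal.mem_sup_right (Ideal.subset_span ⟨i, hi, rfl⟩))

theorem u_relation {k : Type*} [Field k] (q : k) (I : Set ℤ) (j : ℕ) :
    u q I ((j + 1 : ℕ) : ℤ) * (u q I ((j + 2 : ℕ) : ℤ) - u q I ((j + 1 : ℕ) : ℤ)) =
      algebraMap k (Klyachko q I) q *
        (u q I ((j + 1 : ℕ) : ℤ) * (u q I ((j + 1 : ℕ) : ℤ) - u q I (j : ℤ))) := by
  have hmem : MvPolynomial.C (q + 1) * MvPolynomial.X ((j + 1 : ℕ) : ℤ) ^ 2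
        - MvPolynomial.C q * MvPolynomial.X ((j + 1 : ℕ) : ℤ) *
          MvPolynomial.X (((j + 1 : ℕ) : ℤ) - 1)
        - MvPolynomial.X ((j + 1 : ℕ) : ℤ) * MvPolynomial.X (((j + 1 : ℕ) : ℤ) + 1) ∈
      klyachkoIdeal q I := Ideal.mem_sup_left (Ideal.subset_span ⟨_, rfl⟩)
  have h := Ideal.Quotient.eq_zero_iff_mem.2 hmem
  rw [show ((j + 1 : ℕ) : ℤ) - 1 = (j : ℤ) by push_cast; ring,
    show ((j + 1 : ℕ) : ℤ) + 1 = ((j + 2 : ℕ) : ℤ) by push_cast; ring] at h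
  have hC : algebraMap k (Klyachko q I) q =
    Ideal.Quotient.mk (klyachkoIdeal q I) (MvPolynomial.C q) := rfl
  simp only [map_sub, map_mul, map_pow, map_add, map_one] at h
  rw [hC]
  simp only [u]
  linear_combination -h

theorem rhoFin_eq_zero {k : Type*} [Field k] [CharZero k] {q : k}
    (hq : ∀ n : ℕ, 0 < n → q ^ n = 1 → q = 1) {n : ℕ} {f : MvPolynomial (Fin n) k}
    (hf : f ∈ qsymIdeal k n) : rhoFin q n f = 0 := by
  have h := aeval_eq_zero_of_mem_qsymIdeal (v := fun j : ℕ => u q (Set.Ioo 0 (n : ℤ)) (j : ℤ)) hq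
    (u_eq_zero q (by simp)) (u_relation q _) (u_eq_zero q (by simp)) hf
  simpa [rhoFin] using h

theorem rhoPos_fundamental {k : Type*} [Field k] [CharZero k] {q : k}
    (hq : ∀ n : ℕ, 0 < n → q ^ n = 1 → q = 1) {r : ℕ} (hr : 0 < r) (α : Composition r) {m : ℕ}
    (hm : α.length ≤ m) :
    rhoPos q (MvPolynomial.rename Fin.val (fundamental k α m)) =
      (q ^ nStat α / qFactorial q r) •
        ∏ i ∈ Icc (1 + ((m : ℤ) - α.length)) (r + ((m : ℤ) - α.length)),
          u q (Set.Ioi 0) i := by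
  obtain ⟨s, rfl⟩ := Nat.exists_eq_add_of_le hm
  have h := fundEval_of_relations (v := fun j : ℕ => u q (Set.Ioi 0) (j : ℤ)) hq
    (u_eq_zero q (by simp)) (u_relation q _) (mem_insert_self 0 (partialSums α)) r s
  rw [numParts_insert_partialSums hr, descStat_insert_partialSums,
    ← aeval_fundamental (k := k)] at h
  rw [rhoPos, MvPolynomial.aeval_rename]
  have hprod : ∏ i ∈ Icc (1 + (((α.length + s : ℕ) : ℤ) - α.length))
      (r + (((α.length + s : ℕ) : ℤ) - α.length)), u q (Set.Ioi 0) i =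
      ∏ i ∈ range r, u q (Set.Ioi 0) ((i + 1 + s : ℕ) : ℤ) := by
    symm
    refine prod_bij (fun i _ => ((i + 1 + s : ℕ) : ℤ)) ?_ ?_ ?_ fun _ _ => rfl
    · intro i hi
      simp at hi ⊢
      omega
    · intro i _ j _ hij
      simpa using hij
    · intro i hi
      simp at hi
      exact ⟨(i - 1 - s).toNat, by simp; omega, by push_cast; omega⟩
  rw [hprod, ← h]
  simp [Function.comp_def]

/-! ### Principal specializations of quasisymmetric functions -/

theorem constantCoeff_qPochhammer {k : Type*} [Field k] (q : k) (n : ℕ) :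
    PowerSeries.constantCoeff (qPochhammer q n) = 1 := by
  simp [qPochhammer, map_prod]

theorem mk_eval_truncate {k : Type*} [Field k] (q : k) {f : MvPowerSeries ℕ k} {r : ℕ}
    (hr : 0 < r) {s : Finset (Finset ℕ)} {c : Finset ℕ → k}
    (h : ∀ (m : ℕ) (x : ℕ → k), MvPolynomial.aeval (fun i : Fin m => x i) (truncate f m) =
      ∑ S ∈ s, c S • fundEval x (insert 0 S) r m) :
    PowerSeries.mk (fun j : ℕ => if 1 ≤ j then
        MvPolynomial.eval (fun i : Fin j => q ^ (i : ℕ)) (truncate f j) else 0) =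
      (∑ m ∈ range (r + 2), PowerSeries.C
        (∑ S ∈ s, c S * if m = numParts (insert 0 S) r then q ^ descStat (insert 0 S) r else 0) *
          PowerSeries.X ^ m) *
        (qPochhammer q (r + 1))⁻¹ := by
  rw [PowerSeries.eq_mul_inv_iff_mul_eq (by simp [constantCoeff_qPochhammer])]
  have h1 : (PowerSeries.mk (fun j : ℕ => if 1 ≤ j then
      MvPolynomial.eval (fun i : Fin j => q ^ (i : ℕ)) (truncate f j) else 0)) =
      ∑ S ∈ s, PowerSeries.C (c S) * PowerSeries.mk (fundEval (fun j => q ^ j) (insert 0 S) r) := by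
    ext j
    rw [PowerSeries.coeff_mk, map_sum]
    simp only [PowerSeries.coeff_C_mul, PowerSeries.coeff_mk]
    split_ifs with hj
    · exact h j fun j => q ^ j
    -- The coefficient at `j = 0` is zero on both sides, since `r > 0` forces at least one part.
    · symm
      refine sum_eq_zero fun S _ => ?_
      have := numParts_pos (mem_insert_self 0 S) hr
      rw [fundEval_eq_zero _ (by omega), mul_zero]
  rw [h1, sum_mul]
  simp only [map_sum, sum_mul]
  rw [sum_comm]
  refine sum_congr rfl fun S _ => ?_
  have hle := numParts_le (insert 0 S) r
  rw [mul_assoc, mk_fundEval_mul_qPochhammer q (mem_insert_self 0 S),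
    sum_eq_single_of_mem (numParts (insert 0 S) r) (mem_range.2 (by omega))]
  · rw [if_pos rfl, map_mul, mul_assoc]
  · intro m _ hm
    rw [if_neg hm, mul_zero, map_zero, zero_mul]

end QKlyachko

end

theorem theorem1p3 {k : Type*} [Field k] [CharZero k] (q : k)
    (hq : ∀ n : ℕ, 0 < n → q ^ n = 1 → q = 1) (r : ℕ) (hr : 0 < r) :
    -- (1) the generating function of principal specializations
    (∀ f : MvPowerSeries ℕ k, QKlyachko.IsQuasisymmetric f → f.IsHomogeneous r →
      ∃ c : ℕ → k,
        (∀ (m : ℕ) (hm : m ≤ r + 1),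
          QKlyachko.qDS q (MvPolynomial.rename (Fin.castLE hm) (QKlyachko.truncate f m)) =
            algebraMap k (QKlyachko.RatFun k (r + 1)) (c m)) ∧
        PowerSeries.mk (fun j : ℕ => if 1 ≤ j then
            MvPolynomial.eval (fun i : Fin j => q ^ (i : ℕ)) (QKlyachko.truncate f j) else 0) =
          (∑ m ∈ Finset.range (r + 2), PowerSeries.C (c m) * PowerSeries.X ^ m) *
            (QKlyachko.qPochhammer q (r + 1))⁻¹) ∧
    -- (2) vanishing in `K_{r+1}`
    (∀ f : MvPowerSeries ℕ k, QKlyachko.IsQuasisymmetric f → f.IsHomogeneous r →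
      QKlyachko.rhoFin q (r + 1) (QKlyachko.truncate f (r + 1)) = 0) ∧
    -- (3) vanishing of the `q`-divided symmetrization on the degree `r` part of the ideal
    (∀ f ∈ QKlyachko.qsymIdeal k (r + 1), f.totalDegree ≤ r → QKlyachko.qDS q f = 0) ∧
    -- the image of fundamental quasisymmetric polynomials in `K_+`
    (∀ (α : Composition r) (m : ℕ), α.length ≤ m →
      QKlyachko.rhoPos q (MvPolynomial.rename Fin.val (QKlyachko.fundamental k α m)) =
        (q ^ QKlyachko.nStat α / QKlyachko.qFactorial q r) •
          ∏ i ∈ Finset.Icc (1 + ((m : ℤ) - α.length)) (r + ((m : ℤ) - α.length)),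
            QKlyachko.u q (Set.Ioi 0) i) ∧
    -- the `q`-divided symmetrization of fundamental quasisymmetric polynomials
    (∀ (α : Composition r) (m : ℕ) (hm : m ≤ r + 1), α.length ≤ m →
      QKlyachko.qDS q
          (MvPolynomial.rename (Fin.castLE hm) (QKlyachko.fundamental k α m)) =
        if m = α.length then
          algebraMap k (QKlyachko.RatFun k (r + 1)) (q ^ QKlyachko.nStat α) else 0) ∧
    -- vanishing of `ρ_n` on the whole ideal
    (∀ (n : ℕ), ∀ f ∈ QKlyachko.qsymIdeal k n, QKlyachko.rhoFin q n f = 0) := by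
  refine ⟨fun f hf hfr => ?_, fun f hf hfr => ?_, fun f hf hd => ?_, fun α m hm =>
    QKlyachko.rhoPos_fundamental hq hr α hm, fun α m hm _ => ?_,
    fun n f hf => QKlyachko.rhoFin_eq_zero hq hf⟩
  · obtain ⟨c, hc⟩ := hf.exists_fundEval hfr
    -- The witness is found by unification: the value in `qDS_rename_eq` is the numerator
    -- coefficient in `mk_eval_truncate`.
    refine ⟨fun m => _, fun m hm => QKlyachko.qDS_rename_eq hq hr hm
      (QKlyachko.isHomogeneous_truncate hf hfr m) fun x => hc m x,
      QKlyachko.mk_eval_truncate q hr fun m x => hc m x⟩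
  · refine QKlyachko.rhoFin_eq_zero hq (Ideal.subset_span
      ⟨QKlyachko.isQuasisymmetricPoly_truncate hf (r + 1), ?_⟩)
    rw [MvPolynomial.constantCoeff_eq]
    exact (QKlyachko.isHomogeneous_truncate hf hfr (r + 1)).coeff_eq_zero (by simpa using hr.ne)
  · have h := QKlyachko.qDS_eq_of_sub_mem q (c := 0) hd
      (by simpa using QKlyachko.mem_relationIdeal_of_mem_qsymIdeal hq hf)
    rwa [map_zero] at h
  · rw [QKlyachko.qDS_rename_eq hq hr hm (QKlyachko.isHomogeneous_fundamental k α m)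
      (s := {QKlyachko.partialSums α}) (c := fun _ => 1) fun x => by
        rw [Finset.sum_singleton, one_smul, QKlyachko.aeval_fundamental],
      Finset.sum_singleton, one_mul, QKlyachko.numParts_insert_partialSums hr,
      QKlyachko.descStat_insert_partialSums, apply_ite (algebraMap k _), map_zero]
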